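/- Setting. Let $\kappa,m,r$ be the horizon and the dimensions, $A\in\mathbb R^{m\times m}$, $B\in\mathbb R^{m\times r}$, $\Sigma_1,\Sigma_w\in\mathbb R^{m\times m}$ positive semi-definite, $\Omega$ a finite set of attacker types, and $\Omega^o=\Omega\cup\{\omega_o\}$, where $\omega_o\notin\Omega$ stands for the controller of the system. For every $\omega\in\Omega^o$ let $Q^\omega\in\mathbb R^{m\times m}$ be positive semi-definite and $R^\omega\in\mathbb R^{r\times r}$ positive definite. Write $\|x\|_W^2=x'Wx$. The state evolves as $x_{k+1}=Ax_k+Bu_k+w_k$, $k=1,\dots,\kappa$, with $x_1\sim\mathcal N(0,\Sigma_1)$ and $w_k\sim\mathcal N(0,\Sigma_w)$. The sensor observes the state perfectly and picks a linear-plus-noise signaling rule $\eta\in\Upsilon$, that is, arbitrary $L_{k,j}\in\mathbb R^{m\times m}$ ($j\le k$) and positive semi-definite $\Theta_k$, which yields $s_k=\sum_{j\le k}L_{k,j}'x_j+\vartheta_k$ with $\vartheta_k\sim\mathcal N(0,\Theta_k)$; here $x_1,w_1,\dots,w_\kappa,\vartheta_1,\dots,\vartheta_\kappa$ are mutually independent.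 A control policy $\gamma\in\Gamma$ consists of arbitrary Borel functions, $u_k=\gamma_k(s_{1:k})$. Denote by $x_k^\omega,u_k^\omega$ the state and control when type $\omega$ drives the system with its policy $\gamma^\omega$. Type $\omega\in\Omega^o$ minimizes $U_C^\omega(\eta,\gamma^\omega)=\sum_{k=1}^\kappa\big(\mathbb E\|x^\omega_{k+1}\|^2_{Q^\omega}+\mathbb E\|u^\omega_k\|^2_{R^\omega}\big)$ over $\Gamma$, given $\eta$; its minimizers are its best responses. The sensor's objective is $$U_S(\eta,\{\gamma^\omega\})=\max_{p\in\Delta(\Omega^o)}\Big\{\sum_{\omega\in\Omega}p_\omega\sum_{k=1}^\kappa\mathbb E\|x_{k+1}^\omega\|^2_{Q^{\omega_o}}+p_{\omega_o}\sum_{k=1}^\kappa\big(\mathbb E\|x_{k+1}^{\omega_o}\|^2_{Q^{\omega_o}}+\mathbb E\|u_k^{\omega_o}\|^2_{R^{\omega_o}}\big)\Big\},$$ where $\Delta(\Omega^o)$ is the set of probability distributions on $\Omega^o$. Notation. Let $x^o_1=x_1$, $x^o_{k+1}=Ax^o_k+w_k$ be the control-free state, and $H_k=\mathrm{cov}\{\mathbb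 E\{x_k^o\mid s_{1:k}\}\}$. Let $\tilde Q^\omega_{\kappa+1}=Q^\omega$, $\Delta_k^\omega=B'\tilde Q^\omega_{k+1}B+R^\omega$, $\tilde Q_k^\omega=Q^\omega+A'\big(\tilde Q^\omega_{k+1}-\tilde Q^\omega_{k+1}B(\Delta^\omega_k)^{-1}B'\tilde Q^\omega_{k+1}\big)A$, $K_k^\omega=(\Delta_k^\omega)^{-1}B'\tilde Q_{k+1}^\omega A$, $\delta_0^\omega=\mathrm{Tr}\{(\tilde Q_1^\omega-Q^\omega)\Sigma_1\}+\sum_{k=1}^\kappa\mathrm{Tr}\{\tilde Q^\omega_{k+1}\Sigma_w\}$, and, for a policy with controls $u_k$, $u_k^o=u_k+\sum_{j<k}K_k^\omega A^{k-1-j}Bu_j$. Consider $\kappa\times\kappa$ block matrices whose block $(k,l)$ refers to the stages $k,l$: $\Phi^\omega$ has the blocks $I$ for $l=k$, $K_k^\omega A^{k-l-1}B$ for $l<k$, and $0$ for $l>k$; $Z$ has the blocks $A^{k-l}B$ for $l\le k$ and $0$ for $l>k$; $K^\omega$ and $\Delta^\omega$ are block diagonal with blocks $K_k^\omega$ and $\Delta_k^\omega$;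 $\bar A=I_\kappa\otimes A$, $\bar Q=I_\kappa\otimes Q^{\omega_o}$, $T^\omega=Z(\Phi^\omega)^{-1}K^\omega$; $\Sigma^o$ has the blocks $\mathbb E\{x^o_k(x^o_l)'\}$. Put $$V^{\omega_o}=-(K^{\omega_o})'\Delta^{\omega_o}K^{\omega_o},\qquad V^\omega=(T^\omega)'\bar QT^\omega-(T^\omega)'\bar Q\bar A-\bar A'\bar QT^\omega\quad(\omega\in\Omega),$$ $$\Xi_k^\omega=V_{k,k}^\omega+\sum_{l=k+1}^{\kappa}\big(V_{k,l}^\omega A^{l-k}+(A^{l-k})'V_{l,k}^\omega\big)\quad(\omega\in\Omega^o),$$ $$\xi^{\omega_o}=\delta_0^{\omega_o}-\mathrm{Tr}\{\Sigma^o\,\mathrm{diag}(\Xi^{\omega_o}_1,\dots,\Xi^{\omega_o}_\kappa)\},\qquad \xi^\omega=\mathrm{Tr}\{\Sigma^o\bar A'\bar Q\bar A\}+\kappa\,\mathrm{Tr}\{\Sigma_wQ^{\omega_o}\}\quad(\omega\in\Omega).$$ Statement. The matrices $\Xi_k^\omega$ are symmetric, and $H_k$ depends on $\eta$ only, not on the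 control policy. For every $\eta\in\Upsilon$ and $\omega\in\Omega^o$ best responses exist, and they are exactly the policies with $u_k^o=-K_k^\omega\,\mathbb E\{x_k^o\mid s_{1:k}\}$ almost surely for $k=1,\dots,\kappa$. For every choice $\eta\mapsto\{\gamma^\omega(\eta)\}_{\omega\in\Omega^o}$ of best responses and every $\eta\in\Upsilon$, $$U_S\big(\eta,\{\gamma^\omega(\eta)\}\big)=\max_{p\in\Delta(\Omega^o)}\sum_{\omega\in\Omega^o}p_\omega\Big(\xi^\omega+\sum_{k=1}^\kappa\mathrm{Tr}\{H_k\Xi_k^\omega\}\Big),$$ the two expressions that are maximized being equal for every $p$. Hence the sensor's problem of minimizing $U_S(\eta,\{\gamma^\omega(\eta)\})$ over $\eta\in\Upsilon$ is the problem $$\min_{\eta\in\Upsilon}\max_{p\in\Delta(\Omega^o)}\sum_{\omega\in\Omega^o}p_\omega\Big(\xi^\omega+\sum_{k=1}^\kappa\mathrm{Tr}\{H_k\Xi_k^\omega\}\Big):$$ both have the same value (infimum over $\eta$) and the same minimizers. -/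

import Mathlib

open MeasureTheory ProbabilityTheory
open scoped Matrix Kronecker ENNReal

noncomputable section

namespace RobustSensor

/-- Parameters of the control problem with horizon `κ`, states in `ℝ^m`, controls in `ℝ^r`.
The extended type set is `Option Ω`: `none` is the controller of the system, `some ω` is the
attacker of type `ω`. `Q ω`, `R ω` are the weights of the objective of type `ω`. -/
structure Model (κ m r : ℕ) (Ω : Type*) where
  A : Matrix (Fin m) (Fin m) ℝ
  B : Matrix (Fin m) (Fin r) ℝ
  covInit : Matrix (Fin m) (Fin m) ℝ
  covNoise : Matrix (Fin m) (Fin m) ℝ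
  Q : Option Ω → Matrix (Fin m) (Fin m) ℝ
  R : Option Ω → Matrix (Fin r) (Fin r) ℝ
  covInit_posSemidef : covInit.PosSemidef
  covNoise_posSemidef : covNoise.PosSemidef
  Q_posSemidef : ∀ ω, (Q ω).PosSemidef
  R_posDef : ∀ ω, (R ω).PosDef

/-- A linear-plus-noise signaling rule under perfect measurements: at stage `k` an arbitrary gain
matrix, given by its blocks `L_{k,j}` for `j ≤ k`, and an arbitrary positive semi-definite
covariance of the additive signaling noise. Stages `1, …, κ` are indexed by `Fin κ`. -/
structure Signaling (κ m : ℕ) where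
  gain : (k : Fin κ) → Finset.Iic k → Matrix (Fin m) (Fin m) ℝ
  noiseCov : Fin κ → Matrix (Fin m) (Fin m) ℝ
  noiseCov_posSemidef : ∀ k, (noiseCov k).PosSemidef

/-- A control policy: at stage `k` an arbitrary Borel function of the signals up to stage `k`. -/
structure Policy (κ m r : ℕ) where
  act : (k : Fin κ) → (Finset.Iic k → Fin m → ℝ) → Fin r → ℝ
  measurable_act : ∀ k, Measurable (act k)

/-- The primitive random vectors: initial state, state noise and, for every signaling rule, the
signaling noise. They are Gaussian with the prescribed laws and mutually independent. -/
structure Noise {κ m r : ℕ} {Ω : Type*} (M : Model κ m r Ω) {S : Type*} [MeasurableSpace S]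
    (P : Measure S) where
  x₁ : S → Fin m → ℝ
  w : Fin κ → S → Fin m → ℝ
  v : Signaling κ m → Fin κ → S → Fin m → ℝ
  measurable_x₁ : Measurable x₁
  measurable_w : ∀ k, Measurable (w k)
  measurable_v : ∀ η k, Measurable (v η k)
  law_x₁ : HasLaw (fun s => WithLp.toLp 2 (x₁ s)) (multivariateGaussian 0 M.covInit) P
  law_w : ∀ k, HasLaw (fun s => WithLp.toLp 2 (w k s)) (multivariateGaussian 0 M.covNoise) P
  law_v : ∀ η k,
    HasLaw (fun s => WithLp.toLp 2 (v η k s)) (multivariateGaussian 0 (η.noiseCov k)) P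
  indep : ∀ η,
    iIndepFun (Sum.elim (fun _ : Unit => x₁) (Sum.elim w (v η)) :
      Unit ⊕ (Fin κ ⊕ Fin κ) → S → Fin m → ℝ) P

/-- The quadratic form `‖x‖_W² = x' W x`. -/
def quad {n : ℕ} (W : Matrix (Fin n) (Fin n) ℝ) (x : Fin n → ℝ) : ℝ := x ⬝ᵥ (W *ᵥ x)

/-! ### Closed-loop and control-free trajectories -/

section Trajectories

variable {κ m r : ℕ} {Ω : Type*} {M : Model κ m r Ω} {S : Type*} [MeasurableSpace S]
  {P : Measure S}

/-- The closed-loop state: `x_{k+1} = A x_k + B γ_k(s_{1:k}) + w_k`, where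
`s_j = ∑_{i ≤ j} L_{j,i}' x_i + ϑ_j`. The index `t : Fin (κ + 1)` is the time `t + 1`. -/
def Noise.state (N : Noise M P) (η : Signaling κ m) (γ : Policy κ m r) :
    Fin (κ + 1) → S → Fin m → ℝ
  | ⟨0, _⟩, s => N.x₁ s
  | ⟨t + 1, h⟩, s =>
      M.A *ᵥ N.state η γ ⟨t, by omega⟩ s
        + M.B *ᵥ γ.act ⟨t, by omega⟩ (fun j =>
            ∑ i : Finset.Iic j.1, (η.gain j.1 i)ᵀ *ᵥ N.state η γ i.1.castSucc s + N.v η j.1 s)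
        + N.w ⟨t, by omega⟩ s
  termination_by t => t.val
  decreasing_by
    · simp
    · have h1 := Finset.mem_Iic.mp i.2
      have h2 := Finset.mem_Iic.mp j.2
      have h3 := Fin.le_def.mp (h1.trans h2)
      simp at h3 ⊢
      omega

/-- The signal `s_k`. -/
def Noise.signal (N : Noise M P) (η : Signaling κ m) (γ : Policy κ m r) (k : Fin κ) (s : S) :
    Fin m → ℝ :=
  ∑ i : Finset.Iic k, (η.gain k i)ᵀ *ᵥ N.state η γ i.1.castSucc s + N.v η k s

/-- The signals `s_{1:k}`. -/
def Noise.signals (N : Noise M P) (η : Signaling κ m) (γ : Policy κ m r) (k : Fin κ) (s : S) :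
    Finset.Iic k → Fin m → ℝ :=
  fun j => N.signal η γ j.1 s

/-- The control input `u_k = γ_k(s_{1:k})`. -/
def Noise.control (N : Noise M P) (η : Signaling κ m) (γ : Policy κ m r) (k : Fin κ) (s : S) :
    Fin r → ℝ :=
  γ.act k (N.signals η γ k s)

/-- The control-free state: `x°_1 = x_1`, `x°_{k+1} = A x°_k + w_k`. -/
def Noise.freeState (N : Noise M P) : Fin (κ + 1) → S → Fin m → ℝ
  | ⟨0, _⟩, s => N.x₁ s
  | ⟨t + 1, h⟩, s => M.A *ᵥ N.freeState ⟨t, by omega⟩ s + N.w ⟨t, by omega⟩ s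
  termination_by t => t.val

/-- The control-free signals `s°_{1:k}`, with `s°_j = ∑_{i ≤ j} L_{j,i}' x°_i + ϑ_j`. -/
def Noise.freeSignals (N : Noise M P) (η : Signaling κ m) (k : Fin κ) (s : S) :
    Finset.Iic k → Fin m → ℝ :=
  fun j => ∑ i : Finset.Iic j.1, (η.gain j.1 i)ᵀ *ᵥ N.freeState i.1.castSucc s + N.v η j.1 s

/-- The posterior estimate `E{x°_k | s_{1:k}}`. -/
def Noise.posterior (N : Noise M P) (η : Signaling κ m) (γ : Policy κ m r) (k : Fin κ) :
    S → Fin m → ℝ :=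
  P[N.freeState k.castSucc | MeasurableSpace.comap (N.signals η γ k) inferInstance]

/-- The covariance matrix of a random vector. -/
def covMat (P : Measure S) {n : ℕ} (X : S → Fin n → ℝ) : Matrix (Fin n) (Fin n) ℝ :=
  Matrix.of fun i j => cov[fun s => X s i, fun s => X s j; P]

/-- `cov{E{x°_k | s_{1:k}}}` in closed loop, with the control policy `γ`. -/
def Noise.posteriorCov (N : Noise M P) (η : Signaling κ m) (γ : Policy κ m r) (k : Fin κ) :
    Matrix (Fin m) (Fin m) ℝ :=
  covMat P (N.posterior η γ k)

/-- `H_k` as a function of the signaling rule alone: `cov{E{x°_k | s°_{1:k}}}`. -/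
def Noise.H (N : Noise M P) (η : Signaling κ m) (k : Fin κ) : Matrix (Fin m) (Fin m) ℝ :=
  covMat P (P[N.freeState k.castSucc | MeasurableSpace.comap (N.freeSignals η k) inferInstance])

/-! ### Objectives, with values in `[0, ∞]` since policies are arbitrary Borel functions -/

/-- The objective of the type-`ω` controller:
`∑_k E‖x_{k+1}‖²_{Q^ω} + E‖u_k‖²_{R^ω}`. -/
def Noise.controllerCost (N : Noise M P) (ω : Option Ω) (η : Signaling κ m) (γ : Policy κ m r) :
    ℝ≥0∞ :=
  ∑ k : Fin κ, ((∫⁻ s, ENNReal.ofReal (quad (M.Q ω) (N.state η γ k.succ s)) ∂P)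
    + ∫⁻ s, ENNReal.ofReal (quad (M.R ω) (N.control η γ k s)) ∂P)

/-- `γ ∈ argmin U_C^ω(η, ·)`. -/
def Noise.IsBestResponse (N : Noise M P) (ω : Option Ω) (η : Signaling κ m)
    (γ : Policy κ m r) : Prop :=
  ∀ γ' : Policy κ m r, N.controllerCost ω η γ ≤ N.controllerCost ω η γ'

/-- The cost to the sensor when type `ω` drives the system with `γ`: the system's own objective
for `ω = none`, and only its state part `∑_k E‖x_{k+1}‖²_{Q}` (with the system's weight) for an
attacker. -/
def Noise.sensorCost (N : Noise M P) (ω : Option Ω) (η : Signaling κ m) (γ : Policy κ m r) :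
    ℝ≥0∞ :=
  match ω with
  | none => N.controllerCost none η γ
  | some _ => ∑ k : Fin κ, ∫⁻ s, ENNReal.ofReal (quad (M.Q none) (N.state η γ k.succ s)) ∂P

/-- The expected cost to the sensor under the distribution `p` over the types. -/
def Noise.sensorMean [Fintype Ω] (N : Noise M P) (η : Signaling κ m)
    (γ : Option Ω → Policy κ m r) (p : Option Ω → ℝ) : ℝ≥0∞ :=
  ∑ ω, ENNReal.ofReal (p ω) * N.sensorCost ω η (γ ω)

/-- The sensor's objective `U_S`: the worst case over all distributions on the types. -/
def Noise.sensorObjective [Fintype Ω] (N : Noise M P) (η : Signaling κ m)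
    (γ : Option Ω → Policy κ m r) : ℝ≥0∞ :=
  ⨆ p : stdSimplex ℝ (Option Ω), N.sensorMean η γ p

end Trajectories

/-! ### The fixed matrices and scalars

Block matrices are indexed by `Fin κ × Fin m`, the first component being the stage; the block
`(k, l)` of such a matrix refers to the stages `k`, `l`. -/

section Parameters

variable {κ m r : ℕ} {Ω : Type*} (M : Model κ m r Ω)

/-- The backward Riccati recursion, started from `Q^ω` and iterated `n` times. -/
def Model.riccati (M : Model κ m r Ω) (ω : Option Ω) : ℕ → Matrix (Fin m) (Fin m) ℝ
  | 0 => M.Q ω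
  | n + 1 =>
      M.Q ω + M.Aᵀ * (M.riccati ω n - M.riccati ω n * M.B
        * (M.Bᵀ * M.riccati ω n * M.B + M.R ω)⁻¹ * M.Bᵀ * M.riccati ω n) * M.A

/-- `Q̃^ω` at time `t + 1`, for `t = 0, …, κ`; it equals `Q^ω` at time `κ + 1`. -/
def Model.Qt (ω : Option Ω) (t : ℕ) : Matrix (Fin m) (Fin m) ℝ := M.riccati ω (κ - t)

/-- `Δ_k^ω = B' Q̃_{k+1}^ω B + R^ω`. -/
def Model.Del (ω : Option Ω) (k : Fin κ) : Matrix (Fin r) (Fin r) ℝ :=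
  M.Bᵀ * M.Qt ω (k + 1) * M.B + M.R ω

/-- `K_k^ω = (Δ_k^ω)⁻¹ B' Q̃_{k+1}^ω A`. -/
def Model.K (ω : Option Ω) (k : Fin κ) : Matrix (Fin r) (Fin m) ℝ :=
  (M.Del ω k)⁻¹ * M.Bᵀ * M.Qt ω (k + 1) * M.A

/-- `δ_0^ω = Tr{(Q̃_1^ω - Q^ω) Σ_1} + ∑_k Tr{Q̃_{k+1}^ω Σ_w}`. -/
def Model.del0 (ω : Option Ω) : ℝ :=
  ((M.Qt ω 0 - M.Q ω) * M.covInit).trace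
    + ∑ k : Fin κ, (M.Qt ω (k + 1) * M.covNoise).trace

/-- Assembles a block matrix. -/
def ofBlocks {a b : ℕ} (F : Matrix (Fin κ) (Fin κ) (Matrix (Fin a) (Fin b) ℝ)) :
    Matrix (Fin κ × Fin a) (Fin κ × Fin b) ℝ :=
  Matrix.comp (Fin κ) (Fin κ) (Fin a) (Fin b) ℝ F

/-- The block `(k, l)` of a block matrix. -/
def block {a b : ℕ} (V : Matrix (Fin κ × Fin a) (Fin κ × Fin b) ℝ) (k l : Fin κ) :
    Matrix (Fin a) (Fin b) ℝ :=
  (Matrix.comp (Fin κ) (Fin κ) (Fin a) (Fin b) ℝ).symm V k l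

/-- `Φ^ω`: identity blocks on the diagonal, `K_k^ω A^{k-l-1} B` at the stages `l < k`. -/
def Model.Phi (ω : Option Ω) : Matrix (Fin κ × Fin r) (Fin κ × Fin r) ℝ :=
  ofBlocks (Matrix.of fun k l =>
    if l = k then 1
    else if l < k then M.K ω k * M.A ^ ((k : ℕ) - (l : ℕ) - 1) * M.B else 0)

/-- The block diagonal matrix of the `K_k^ω`. -/
def Model.Kbar (ω : Option Ω) : Matrix (Fin κ × Fin r) (Fin κ × Fin m) ℝ :=
  ofBlocks (Matrix.diagonal (M.K ω))

/-- The block diagonal matrix of the `Δ_k^ω`. -/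
def Model.Delbar (ω : Option Ω) : Matrix (Fin κ × Fin r) (Fin κ × Fin r) ℝ :=
  ofBlocks (Matrix.diagonal (M.Del ω))

/-- `Z`: the blocks `A^{k-l} B` at the stages `l ≤ k`. -/
def Model.Z : Matrix (Fin κ × Fin m) (Fin κ × Fin r) ℝ :=
  ofBlocks (Matrix.of fun k l => if l ≤ k then M.A ^ ((k : ℕ) - (l : ℕ)) * M.B else 0)

/-- `I_κ ⊗ A`. -/
def Model.Abar : Matrix (Fin κ × Fin m) (Fin κ × Fin m) ℝ :=
  (1 : Matrix (Fin κ) (Fin κ) ℝ) ⊗ₖ M.A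

/-- `I_κ ⊗ Q`, with the weight `Q` of the system. -/
def Model.Qbar : Matrix (Fin κ × Fin m) (Fin κ × Fin m) ℝ :=
  (1 : Matrix (Fin κ) (Fin κ) ℝ) ⊗ₖ M.Q none

/-- `T^ω = Z (Φ^ω)⁻¹ K^ω`. -/
def Model.T (ω : Option Ω) : Matrix (Fin κ × Fin m) (Fin κ × Fin m) ℝ :=
  M.Z * (M.Phi ω)⁻¹ * M.Kbar ω

/-- `V^ω`. -/
def Model.V (ω : Option Ω) : Matrix (Fin κ × Fin m) (Fin κ × Fin m) ℝ :=
  match ω with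
  | none => -((M.Kbar none)ᵀ * M.Delbar none * M.Kbar none)
  | some ω =>
      (M.T (some ω))ᵀ * M.Qbar * M.T (some ω) - (M.T (some ω))ᵀ * M.Qbar * M.Abar
        - M.Abarᵀ * M.Qbar * M.T (some ω)

/-- `Ξ_k^ω = V_{k,k}^ω + ∑_{l > k} (V_{k,l}^ω A^{l-k} + (A^{l-k})' V_{l,k}^ω)`. -/
def Model.Xi (ω : Option Ω) (k : Fin κ) : Matrix (Fin m) (Fin m) ℝ :=
  block (M.V ω) k k + ∑ l ∈ Finset.Ioi k,
    (block (M.V ω) k l * M.A ^ ((l : ℕ) - (k : ℕ))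
      + (M.A ^ ((l : ℕ) - (k : ℕ)))ᵀ * block (M.V ω) l k)

variable {M} {S : Type*} [MeasurableSpace S] {P : Measure S}

/-- `Σ° = E{x° (x°)'}` for the vector `x°` of the control-free states at the stages `1, …, κ`. -/
def Noise.freeCov (N : Noise M P) : Matrix (Fin κ × Fin m) (Fin κ × Fin m) ℝ :=
  Matrix.of fun a b =>
    ∫ s, N.freeState a.1.castSucc s a.2 * N.freeState b.1.castSucc s b.2 ∂P

/-- `ξ^ω`. -/
def Noise.xi (N : Noise M P) (ω : Option Ω) : ℝ :=
  match ω with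
  | none => M.del0 none - (N.freeCov * ofBlocks (Matrix.diagonal (M.Xi none))).trace
  | some _ =>
      (N.freeCov * M.Abarᵀ * M.Qbar * M.Abar).trace + κ * (M.covNoise * M.Q none).trace

/-- The linear objective `∑_ω p_ω (ξ^ω + ∑_k Tr{H_k Ξ_k^ω})`. -/
def Noise.linearObjective [Fintype Ω] (N : Noise M P) (H : Fin κ → Matrix (Fin m) (Fin m) ℝ)
    (p : Option Ω → ℝ) : ℝ :=
  ∑ ω, p ω * (N.xi ω + ∑ k : Fin κ, (H k * M.Xi ω k).trace)

/-- The transformed control `u°_k = u_k + ∑_{j < k} K_k^ω A^{k-1-j} B u_j`. -/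
def Noise.freeControl (N : Noise M P) (ω : Option Ω) (η : Signaling κ m) (γ : Policy κ m r)
    (k : Fin κ) (s : S) : Fin r → ℝ :=
  N.control η γ k s
    + ∑ j ∈ Finset.Iio k,
        (M.K ω k * M.A ^ ((k : ℕ) - (j : ℕ) - 1) * M.B) *ᵥ N.control η γ j s

end Parameters

end RobustSensor

end

/-!
The controls shift the signals by an amount that is known from the previous signals, so the signals
carry the same information as those of the control-free state `x°`, whatever the policy is.
Completing squares along the Riccati recursion, and splitting `x°_k` into its estimate `p_k` and an
error orthogonal to everything the signals determine, writes the cost of a controller as a constant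
depending on `η` plus the nonnegative excess `∑_k E‖u°_k + K_k p_k‖²_{Δ_k}`, which vanishes exactly
for the feedback policies.

The stacked controls of a best response are `-Φ⁻¹ K p`, so they contribute `-T p` to the stacked
states; since `V = (Ā - T)' Q̄ (Ā - T) - Ā' Q̄ Ā`, the cost to the sensor is a constant plus
`E[p' V p]`. As `E[p_k p_l'] = H_k (A^{l-k})'` for `k ≤ l`, the blocks of `V` enter this expectation
only through the `Ξ_k`.
-/

noncomputable section

namespace RobustSensor

/-! ### Quadratic forms and the Riccati recursion -/

section QuadraticForms

variable {n l : ℕ}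

lemma isSymm_of_posSemidef {W : Matrix (Fin n) (Fin n) ℝ} (hW : W.PosSemidef) : W.IsSymm :=
  Matrix.isHermitian_iff_isSymm.1 hW.isHermitian

lemma dotProduct_mulVec_comm {W : Matrix (Fin n) (Fin n) ℝ} (hW : W.IsSymm) (x y : Fin n → ℝ) :
    x ⬝ᵥ (W *ᵥ y) = y ⬝ᵥ (W *ᵥ x) := by
  rw [← Matrix.dotProduct_transpose_mulVec, hW.eq]

lemma quad_nonneg {W : Matrix (Fin n) (Fin n) ℝ} (hW : W.PosSemidef) (x : Fin n → ℝ) :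
    0 ≤ quad W x :=
  hW.dotProduct_mulVec_nonneg x

lemma quad_eq_zero_iff {W : Matrix (Fin n) (Fin n) ℝ} (hW : W.PosDef) {x : Fin n → ℝ} :
    quad W x = 0 ↔ x = 0 := by
  refine ⟨fun h => ?_, fun h => by simp [quad, h]⟩
  by_contra hx
  exact (hW.dotProduct_mulVec_pos hx).ne' h

lemma quad_sub_matrix (V W : Matrix (Fin n) (Fin n) ℝ) (x : Fin n → ℝ) :
    quad (V - W) x = quad V x - quad W x := by
  simp [quad, Matrix.sub_mulVec]

lemma quad_mulVec (W : Matrix (Fin n) (Fin n) ℝ) (F : Matrix (Fin n) (Fin l) ℝ)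
    (x : Fin l → ℝ) : quad W (F *ᵥ x) = quad (Fᵀ * W * F) x := by
  rw [quad, quad, ← Matrix.mulVec_mulVec, ← Matrix.mulVec_mulVec,
    Matrix.dotProduct_transpose_mulVec, dotProduct_comm]

lemma quad_add {W : Matrix (Fin n) (Fin n) ℝ} (hW : W.IsSymm) (x y : Fin n → ℝ) :
    quad W (x + y) = quad W x + 2 * (x ⬝ᵥ (W *ᵥ y)) + quad W y := by
  simp only [quad, Matrix.mulVec_add, add_dotProduct, dotProduct_add,
    dotProduct_mulVec_comm hW y x]
  ring

lemma posDef_transpose_mul_mul_add {W : Matrix (Fin n) (Fin n) ℝ} (hW : W.PosSemidef)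
    (B : Matrix (Fin n) (Fin l) ℝ) {R : Matrix (Fin l) (Fin l) ℝ} (hR : R.PosDef) :
    (Bᵀ * W * B + R).PosDef :=
  .posSemidef_add (hW.conjTranspose_mul_mul_same B) hR

lemma quad_mulVec_add_mulVec_add_quad {W : Matrix (Fin n) (Fin n) ℝ} (hW : W.PosSemidef)
    (A : Matrix (Fin n) (Fin n) ℝ) (B : Matrix (Fin n) (Fin l) ℝ) {R : Matrix (Fin l) (Fin l) ℝ}
    (hR : R.PosDef) (x : Fin n → ℝ) (u : Fin l → ℝ) :
    quad W (A *ᵥ x + B *ᵥ u) + quad R u =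
      quad (Aᵀ * (W - W * B * (Bᵀ * W * B + R)⁻¹ * Bᵀ * W) * A) x
        + quad (Bᵀ * W * B + R) (u + ((Bᵀ * W * B + R)⁻¹ * Bᵀ * W * A) *ᵥ x) := by
  have hD := posDef_transpose_mul_mul_add hW B hR
  set D := Bᵀ * W * B + R with hDdef
  set G := D⁻¹ * Bᵀ * W * A with hGdef
  have hDG (v : Fin l → ℝ) : v ⬝ᵥ (D *ᵥ (G *ᵥ x)) = (A *ᵥ x) ⬝ᵥ (W *ᵥ (B *ᵥ v)) := by
    have hmul : D * G = Bᵀ * (W * A) := by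
      rw [hGdef]
      simp only [Matrix.mul_assoc]
      exact Matrix.mul_nonsing_inv_cancel_left D _ hD.det_pos.ne'.isUnit
    rw [Matrix.mulVec_mulVec, hmul, ← Matrix.mulVec_mulVec, Matrix.dotProduct_transpose_mulVec,
      ← Matrix.mulVec_mulVec, dotProduct_comm, dotProduct_mulVec_comm (isSymm_of_posSemidef hW)]
  have hx : quad (Aᵀ * (W - W * B * D⁻¹ * Bᵀ * W) * A) x
      = quad W (A *ᵥ x) - quad D (G *ᵥ x) := by
    rw [← quad_mulVec, quad_sub_matrix, quad, quad, quad, hDG]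
    simp only [hGdef, Matrix.mulVec_mulVec, Matrix.mul_assoc]
  have hu : quad D u = quad W (B *ᵥ u) + quad R u := by
    rw [quad_mulVec]
    simp only [hDdef, quad, Matrix.add_mulVec, dotProduct_add]
  rw [quad_add (isSymm_of_posSemidef hW), quad_add (isSymm_of_posSemidef hD.posSemidef), hx, hu,
    hDG]
  ring

lemma posSemidef_riccati_step {W : Matrix (Fin n) (Fin n) ℝ} (hW : W.PosSemidef)
    (A : Matrix (Fin n) (Fin n) ℝ) (B : Matrix (Fin n) (Fin l) ℝ) {R : Matrix (Fin l) (Fin l) ℝ}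
    (hR : R.PosDef) :
    (Aᵀ * (W - W * B * (Bᵀ * W * B + R)⁻¹ * Bᵀ * W) * A).PosSemidef := by
  have hWs := isSymm_of_posSemidef hW
  have hDs := isSymm_of_posSemidef (posDef_transpose_mul_mul_add hW B hR).posSemidef
  refine .of_dotProduct_mulVec_nonneg (Matrix.isHermitian_iff_isSymm.2 ?_) fun x => ?_
  · generalize Bᵀ * W * B + R = D at hDs
    simp only [Matrix.IsSymm, Matrix.transpose_mul, Matrix.transpose_sub,
      Matrix.transpose_transpose, Matrix.transpose_nonsing_inv, hWs.eq, hDs.eq, Matrix.mul_assoc]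
  · have hstep := quad_mulVec_add_mulVec_add_quad hW A B hR x
      (-(((Bᵀ * W * B + R)⁻¹ * Bᵀ * W * A) *ᵥ x))
    rw [neg_add_cancel, show quad (Bᵀ * W * B + R) 0 = 0 by simp [quad], add_zero] at hstep
    exact (add_nonneg (quad_nonneg hW _) (quad_nonneg hR.posSemidef _)).trans_eq hstep

end QuadraticForms

section Riccati

variable {κ m r : ℕ} {Ω : Type*} (M : Model κ m r Ω)

lemma Model.Qt_last (ω : Option Ω) : M.Qt ω κ = M.Q ω := by
  simp only [Model.Qt, Nat.sub_self, Model.riccati]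

lemma Model.Qt_eq_Q_add (ω : Option Ω) (k : Fin κ) :
    M.Qt ω k = M.Q ω + M.Aᵀ * (M.Qt ω (k + 1) - M.Qt ω (k + 1) * M.B * (M.Del ω k)⁻¹ * M.Bᵀ
      * M.Qt ω (k + 1)) * M.A := by
  have hk : κ - (k : ℕ) = κ - (k + 1) + 1 := by omega
  simp only [Model.Del, Model.Qt, hk, Model.riccati]

lemma Model.Qt_posSemidef (ω : Option Ω) (t : ℕ) : (M.Qt ω t).PosSemidef := by
  rw [Model.Qt]
  induction κ - t with
  | zero => exact M.Q_posSemidef ω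
  | succ n ih =>
    exact (M.Q_posSemidef ω).add (posSemidef_riccati_step ih M.A M.B (M.R_posDef ω))

lemma Model.Del_posDef (ω : Option Ω) (k : Fin κ) : (M.Del ω k).PosDef :=
  posDef_transpose_mul_mul_add (M.Qt_posSemidef ω _) M.B (M.R_posDef ω)

lemma Model.quad_Qt_add_quad_R (ω : Option Ω) (k : Fin κ) (x : Fin m → ℝ) (u : Fin r → ℝ) :
    quad (M.Qt ω (k + 1)) (M.A *ᵥ x + M.B *ᵥ u) + quad (M.R ω) u =
      quad (M.Qt ω k - M.Q ω) x + quad (M.Del ω k) (u + M.K ω k *ᵥ x) := by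
  rw [M.Qt_eq_Q_add, add_sub_cancel_left]
  exact quad_mulVec_add_mulVec_add_quad (M.Qt_posSemidef ω _) M.A M.B (M.R_posDef ω) x u

end Riccati

/-! ### Block matrices -/

section Blocks

variable {κ a b : ℕ}

lemma ofBlocks_apply (F : Matrix (Fin κ) (Fin κ) (Matrix (Fin a) (Fin b) ℝ))
    (p : Fin κ × Fin a) (q : Fin κ × Fin b) : ofBlocks F p q = F p.1 q.1 p.2 q.2 := rfl

lemma block_ofBlocks (F : Matrix (Fin κ) (Fin κ) (Matrix (Fin a) (Fin b) ℝ)) (k l : Fin κ) :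
    block (ofBlocks F) k l = F k l := rfl

lemma block_transpose (V : Matrix (Fin κ × Fin a) (Fin κ × Fin b) ℝ) (k l : Fin κ) :
    block Vᵀ l k = (block V k l)ᵀ := rfl

lemma ofBlocks_mulVec (F : Matrix (Fin κ) (Fin κ) (Matrix (Fin a) (Fin b) ℝ))
    (X : Fin κ → Fin b → ℝ) :
    ofBlocks F *ᵥ Function.uncurry X = Function.uncurry fun k => ∑ l, F k l *ᵥ X l := by
  ext ⟨k, i⟩
  simp [Matrix.mulVec, dotProduct, Fintype.sum_prod_type, ofBlocks_apply, Finset.sum_apply]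

lemma ofBlocks_diagonal_mulVec (D : Fin κ → Matrix (Fin a) (Fin b) ℝ) (X : Fin κ → Fin b → ℝ) :
    ofBlocks (Matrix.diagonal D) *ᵥ Function.uncurry X = Function.uncurry fun k => D k *ᵥ X k := by
  rw [ofBlocks_mulVec]
  congr 1
  ext1 k
  rw [Finset.sum_eq_single k (fun l _ hl => by simp [Matrix.diagonal_apply_ne' _ hl]) (by simp),
    Matrix.diagonal_apply_eq]

lemma ofBlocks_diagonal_mul {c : ℕ} (D : Fin κ → Matrix (Fin a) (Fin b) ℝ)
    (E : Fin κ → Matrix (Fin b) (Fin c) ℝ) :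
    ofBlocks (Matrix.diagonal D) * ofBlocks (Matrix.diagonal E)
      = ofBlocks (Matrix.diagonal fun k => D k * E k) := by
  refine Matrix.mulVec_injective (funext fun v => ?_)
  obtain ⟨X, rfl⟩ : ∃ X, v = Function.uncurry X := ⟨Function.curry v, rfl⟩
  simp only [← Matrix.mulVec_mulVec, ofBlocks_diagonal_mulVec]

lemma ofBlocks_diagonal_transpose (D : Fin κ → Matrix (Fin a) (Fin b) ℝ) :
    (ofBlocks (Matrix.diagonal D))ᵀ = ofBlocks (Matrix.diagonal fun k => (D k)ᵀ) := by
  ext ⟨k, i⟩ ⟨l, j⟩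
  rw [Matrix.transpose_apply, ofBlocks_apply, ofBlocks_apply]
  obtain rfl | hkl := eq_or_ne k l
  · simp only [Matrix.diagonal_apply_eq, Matrix.transpose_apply]
  · simp only [Matrix.diagonal_apply_ne _ hkl, Matrix.diagonal_apply_ne' _ hkl, Matrix.zero_apply]

lemma one_kronecker_eq_ofBlocks_diagonal (W : Matrix (Fin a) (Fin b) ℝ) :
    (1 : Matrix (Fin κ) (Fin κ) ℝ) ⊗ₖ W = ofBlocks (Matrix.diagonal fun _ => W) := by
  ext ⟨k, i⟩ ⟨l, j⟩
  rw [ofBlocks_apply, Matrix.kroneckerMap_apply]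
  obtain rfl | hkl := eq_or_ne k l
  · simp
  · simp [hkl]

lemma uncurry_dotProduct (X Y : Fin κ → Fin a → ℝ) :
    Function.uncurry X ⬝ᵥ Function.uncurry Y = ∑ k, X k ⬝ᵥ Y k := by
  simp [dotProduct, Fintype.sum_prod_type]

lemma trace_mul_eq_sum_block (G : Matrix (Fin κ × Fin a) (Fin κ × Fin b) ℝ)
    (V : Matrix (Fin κ × Fin b) (Fin κ × Fin a) ℝ) :
    (G * V).trace = ∑ k, ∑ l, (block G k l * block V l k).trace := by
  simp only [Matrix.trace, Matrix.diag_apply, Matrix.mul_apply, Fintype.sum_prod_type]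
  exact Finset.sum_congr rfl fun k _ => Finset.sum_comm

lemma trace_mul_ofBlocks_diagonal (G : Matrix (Fin κ × Fin a) (Fin κ × Fin b) ℝ)
    (D : Fin κ → Matrix (Fin b) (Fin a) ℝ) :
    (G * ofBlocks (Matrix.diagonal D)).trace = ∑ k, (block G k k * D k).trace := by
  rw [trace_mul_eq_sum_block]
  refine Finset.sum_congr rfl fun k _ => ?_
  rw [Finset.sum_eq_single k (fun l _ hl => by simp [block_ofBlocks, hl]) (by simp),
    block_ofBlocks, Matrix.diagonal_apply_eq]

lemma sum_sum_eq_sum_add_sum_Ioi {ι R : Type*} [Fintype ι] [LinearOrder ι]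
    [LocallyFiniteOrderTop ι] [AddCommMonoid R] (f : ι → ι → R) :
    ∑ k, ∑ l, f k l = ∑ k, (f k k + ∑ l ∈ Finset.Ioi k, (f k l + f l k)) := by
  classical
  have hrow (k : ι) : ∑ l, f k l
      = f k k + ∑ l ∈ Finset.Ioi k, f k l + ∑ l with l < k, f k l := by
    rw [← Finset.sum_filter_not_add_sum_filter _ (· < k)]
    congr 1
    rw [← Finset.sum_insert (by simp)]
    congr 1
    ext l
    simp [le_iff_eq_or_lt]
  have hswap : ∑ k, ∑ l with l < k, f k l = ∑ k, ∑ l ∈ Finset.Ioi k, f l k :=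
    Finset.sum_comm' (by simp)
  simp only [hrow, Finset.sum_add_distrib, hswap, add_assoc]

end Blocks

section StackedModel

variable {κ m r : ℕ} {Ω : Type*} (M : Model κ m r Ω)

lemma Model.Phi_mulVec (ω : Option Ω) (U : Fin κ → Fin r → ℝ) :
    M.Phi ω *ᵥ Function.uncurry U = Function.uncurry fun k : Fin κ => U k + ∑ j ∈ Finset.Iio k,
      (M.K ω k * M.A ^ ((k : ℕ) - (j : ℕ) - 1) * M.B) *ᵥ U j := by
  rw [Model.Phi, ofBlocks_mulVec]
  congr 1
  ext1 k
  rw [← Finset.sum_subset (Finset.subset_univ (Finset.Iic k)), ← Finset.Iio_insert,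
    Finset.sum_insert (by simp)]
  · congr 1
    · simp
    · refine Finset.sum_congr rfl fun l hl => ?_
      rw [Finset.mem_Iio] at hl
      simp [hl, hl.ne]
  · intro l _ hl
    rw [Finset.mem_Iic, not_le] at hl
    simp [hl.ne', hl.not_gt]

lemma Model.Z_mulVec (U : Fin κ → Fin r → ℝ) :
    M.Z *ᵥ Function.uncurry U = Function.uncurry fun k : Fin κ =>
      ∑ j ∈ Finset.Iic k, (M.A ^ ((k : ℕ) - (j : ℕ)) * M.B) *ᵥ U j := by
  rw [Model.Z, ofBlocks_mulVec]
  congr 1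
  ext1 k
  rw [← Finset.sum_subset (Finset.subset_univ (Finset.Iic k))]
  · exact Finset.sum_congr rfl fun l hl => by simp [Finset.mem_Iic.1 hl]
  · intro l _ hl
    rw [Finset.mem_Iic] at hl
    simp [hl]

lemma Model.isUnit_det_Phi (ω : Option Ω) : IsUnit (M.Phi ω).det := by
  rw [isUnit_iff_ne_zero, ne_eq, ← Matrix.exists_mulVec_eq_zero_iff]
  rintro ⟨v, hv, h⟩
  obtain ⟨U, rfl⟩ : ∃ U, v = Function.uncurry U := ⟨Function.curry v, rfl⟩
  rw [M.Phi_mulVec] at h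
  refine hv (funext fun ⟨k, i⟩ => congrFun (?_ : U k = 0) i)
  induction k using WellFoundedLT.induction with
  | ind k ih =>
    have hk : U k + ∑ j ∈ Finset.Iio k,
        (M.K ω k * M.A ^ ((k : ℕ) - (j : ℕ) - 1) * M.B) *ᵥ U j = 0 :=
      funext fun i => congrFun h (k, i)
    rwa [Finset.sum_eq_zero, add_zero] at hk
    intro j hj
    rw [ih j (Finset.mem_Iio.1 hj), Matrix.mulVec_zero]

lemma Model.Z_mulVec_of_Phi_mulVec {ω : Option Ω} {u : Fin κ × Fin r → ℝ} {x : Fin κ × Fin m → ℝ}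
    (h : M.Phi ω *ᵥ u = -(M.Kbar ω *ᵥ x)) : M.Z *ᵥ u = -(M.T ω *ᵥ x) := by
  have hu : u = -((M.Phi ω)⁻¹ *ᵥ (M.Kbar ω *ᵥ x)) := by
    rw [← Matrix.mulVec_neg, ← h, Matrix.mulVec_mulVec,
      Matrix.nonsing_inv_mul _ (M.isUnit_det_Phi ω), Matrix.one_mulVec]
  rw [hu, Matrix.mulVec_neg, Model.T, Matrix.mulVec_mulVec, Matrix.mulVec_mulVec]

lemma Model.Abar_mulVec (X : Fin κ → Fin m → ℝ) :
    M.Abar *ᵥ Function.uncurry X = Function.uncurry fun k => M.A *ᵥ X k := by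
  rw [Model.Abar, one_kronecker_eq_ofBlocks_diagonal, ofBlocks_diagonal_mulVec]

lemma Model.uncurry_dotProduct_Qbar_mulVec (X : Fin κ → Fin m → ℝ) :
    Function.uncurry X ⬝ᵥ (M.Qbar *ᵥ Function.uncurry X) = ∑ k, quad (M.Q none) (X k) := by
  rw [Model.Qbar, one_kronecker_eq_ofBlocks_diagonal, ofBlocks_diagonal_mulVec,
    uncurry_dotProduct]
  rfl

lemma Model.V_none : M.V none
    = ofBlocks (Matrix.diagonal fun k => -((M.K none k)ᵀ * M.Del none k * M.K none k)) := by
  rw [Model.V, Model.Kbar, Model.Delbar, ofBlocks_diagonal_transpose, ofBlocks_diagonal_mul,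
    ofBlocks_diagonal_mul, ← Matrix.diagonal_neg]
  rfl

lemma Model.V_some (ω : Ω) : M.V (some ω)
    = (M.Abar - M.T (some ω))ᵀ * M.Qbar * (M.Abar - M.T (some ω))
      - M.Abarᵀ * M.Qbar * M.Abar := by
  simp only [Model.V, Matrix.transpose_sub, Matrix.sub_mul, Matrix.mul_sub]
  abel

lemma Model.dotProduct_V_some_mulVec (ω : Ω) (x : Fin κ × Fin m → ℝ) :
    x ⬝ᵥ (M.V (some ω) *ᵥ x)
      = (M.Abar *ᵥ x - M.T (some ω) *ᵥ x) ⬝ᵥ (M.Qbar *ᵥ (M.Abar *ᵥ x - M.T (some ω) *ᵥ x))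
        - (M.Abar *ᵥ x) ⬝ᵥ (M.Qbar *ᵥ (M.Abar *ᵥ x)) := by
  rw [M.V_some, Matrix.sub_mulVec, dotProduct_sub, ← Matrix.sub_mulVec]
  simp only [← Matrix.mulVec_mulVec, Matrix.dotProduct_transpose_mulVec, dotProduct_comm]

lemma Model.Qbar_isSymm : M.Qbar.IsSymm := by
  rw [Matrix.IsSymm, Model.Qbar, ← Matrix.kroneckerMap_transpose, Matrix.transpose_one,
    (isSymm_of_posSemidef (M.Q_posSemidef none)).eq]

lemma Model.V_isSymm (ω : Option Ω) : (M.V ω).IsSymm := by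
  cases ω with
  | none =>
    have hDel (k : Fin κ) := isSymm_of_posSemidef (M.Del_posDef none k).posSemidef
    simp only [Matrix.IsSymm, M.V_none, ofBlocks_diagonal_transpose, Matrix.transpose_neg,
      Matrix.transpose_mul, Matrix.transpose_transpose, (hDel _).eq, Matrix.mul_assoc]
  | some ω =>
    simp only [Matrix.IsSymm, M.V_some, Matrix.transpose_sub, Matrix.transpose_mul,
      Matrix.transpose_transpose, M.Qbar_isSymm.eq, Matrix.mul_assoc]

lemma Model.Xi_isSymm (ω : Option Ω) (k : Fin κ) : (M.Xi ω k).IsSymm := by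
  have hV (k l : Fin κ) : (block (M.V ω) k l)ᵀ = block (M.V ω) l k := by
    rw [← block_transpose, (M.V_isSymm ω).eq]
  simp only [Matrix.IsSymm, Model.Xi, Matrix.transpose_add, Matrix.transpose_sum,
    Matrix.transpose_mul, Matrix.transpose_transpose, hV]
  congr 1
  exact Finset.sum_congr rfl fun l _ => add_comm _ _

lemma Model.Xi_none (k : Fin κ) :
    M.Xi none k = -((M.K none k)ᵀ * M.Del none k * M.K none k) := by
  rw [Model.Xi, M.V_none, Finset.sum_eq_zero, block_ofBlocks, Matrix.diagonal_apply_eq, add_zero]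
  intro l hl
  have hne := (Finset.mem_Ioi.1 hl).ne
  simp [block_ofBlocks, Matrix.diagonal_apply_ne _ hne, Matrix.diagonal_apply_ne' _ hne]

lemma Model.trace_mul_V {G : Matrix (Fin κ × Fin m) (Fin κ × Fin m) ℝ} (hGs : G.IsSymm)
    {H : Fin κ → Matrix (Fin m) (Fin m) ℝ}
    (hG : ∀ k l, k ≤ l → block G k l = H k * (M.A ^ ((l : ℕ) - (k : ℕ)))ᵀ) (ω : Option Ω) :
    (G * M.V ω).trace = ∑ k, (H k * M.Xi ω k).trace := by
  have hGH (k : Fin κ) : block G k k = H k := by simp [hG k k le_rfl]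
  have hHs (k : Fin κ) : (H k)ᵀ = H k := by rw [← hGH, ← block_transpose, hGs.eq]
  have hG' (k l : Fin κ) (hkl : k ≤ l) : block G l k = M.A ^ ((l : ℕ) - (k : ℕ)) * H k := by
    rw [← hGs.eq, block_transpose, hG k l hkl, Matrix.transpose_mul, Matrix.transpose_transpose,
      hHs k]
  rw [trace_mul_eq_sum_block, sum_sum_eq_sum_add_sum_Ioi]
  refine Finset.sum_congr rfl fun k _ => ?_
  rw [Model.Xi, Matrix.mul_add, Matrix.trace_add, Matrix.mul_sum, Matrix.trace_sum, hGH]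
  congr 1
  refine Finset.sum_congr rfl fun l hl => ?_
  have hkl := (Finset.mem_Ioi.1 hl).le
  rw [hG k l hkl, hG' k l hkl, Matrix.mul_add, Matrix.trace_add, add_comm, Matrix.mul_assoc,
    Matrix.trace_mul_comm, Matrix.mul_assoc, Matrix.mul_assoc]

end StackedModel

/-! ### Second moments of random vectors -/

section Measurability

variable {S : Type*} {mS : MeasurableSpace S} {ι ι' : Type*}

-- Unlike `measurable_pi_lambda`, this can be applied with a σ-algebra that is not an instance.
lemma measurable_of_forall_apply {β : Type*} [MeasurableSpace β] {X : S → ι → β}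
    (hX : ∀ i, Measurable fun s => X s i) : Measurable X :=
  measurable_pi_lambda _ hX

variable [Fintype ι] [Countable ι']

lemma measurable_mulVec {X : S → ι → ℝ} (hX : Measurable X) (W : Matrix ι' ι ℝ) :
    Measurable fun s => W *ᵥ X s :=
  (Continuous.matrix_mulVec continuous_const continuous_id).measurable.comp hX

end Measurability

section SecondMoments

variable {S : Type*} {mS : MeasurableSpace S} {P : Measure S} {ι ι' ι'' : Type*}

/-- The matrix `E{X Y'}` of the mixed second moments of two random vectors. -/
def crossMoment (P : Measure S) (X : S → ι → ℝ) (Y : S → ι' → ℝ) : Matrix ι ι' ℝ :=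
  Matrix.of fun i j => ∫ s, X s i * Y s j ∂P

lemma crossMoment_transpose (X : S → ι → ℝ) (Y : S → ι' → ℝ) :
    (crossMoment P X Y)ᵀ = crossMoment P Y X := by
  ext i j
  simp only [crossMoment, Matrix.transpose_apply, Matrix.of_apply, mul_comm]

variable [Fintype ι']

lemma crossMoment_eq_zero_of_indepFun {X : S → ι → ℝ} {Y : S → ι' → ℝ}
    (hX : AEStronglyMeasurable X P) (hY : Integrable Y P) (h : IndepFun X Y P)
    (hY0 : ∫ s, Y s ∂P = 0) : crossMoment P X Y = 0 := by
  ext i j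
  have hij : IndepFun (fun s => X s i) (fun s => Y s j) P :=
    h.comp (measurable_pi_apply i) (measurable_pi_apply j)
  have hY0j : ∫ s, Y s j ∂P = 0 := by rw [← eval_integral fun j => hY.eval j, hY0, Pi.zero_apply]
  simp only [crossMoment, Matrix.of_apply, Matrix.zero_apply]
  rw [hij.integral_fun_mul_eq_mul_integral ((continuous_apply i).comp_aestronglyMeasurable hX)
    (hY.eval j).1, hY0j, mul_zero]

variable [Fintype ι]

lemma memLp_mulVec {X : S → ι → ℝ} (hX : MemLp X 2 P) (W : Matrix ι' ι ℝ) :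
    MemLp (fun s => W *ᵥ X s) 2 P :=
  (LinearMap.toContinuousLinearMap W.mulVecLin).comp_memLp' hX

lemma integral_mulVec {X : S → ι → ℝ} (hX : Integrable X P) (W : Matrix ι' ι ℝ) :
    ∫ s, W *ᵥ X s ∂P = W *ᵥ ∫ s, X s ∂P :=
  (LinearMap.toContinuousLinearMap W.mulVecLin).integral_comp_comm hX

lemma integrable_apply_mul_apply {X : S → ι → ℝ} {Y : S → ι' → ℝ} (hX : MemLp X 2 P)
    (hY : MemLp Y 2 P) (i : ι) (j : ι') : Integrable (fun s => X s i * Y s j) P :=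
  (hX.eval i).integrable_mul (hY.eval j)

lemma integrable_dotProduct {X Y : S → ι → ℝ} (hX : MemLp X 2 P) (hY : MemLp Y 2 P) :
    Integrable (fun s => X s ⬝ᵥ Y s) P :=
  integrable_finsetSum _ fun i _ => integrable_apply_mul_apply hX hY i i

lemma crossMoment_add_right {X : S → ι → ℝ} {Y Z : S → ι' → ℝ} (hX : MemLp X 2 P)
    (hY : MemLp Y 2 P) (hZ : MemLp Z 2 P) :
    crossMoment P X (fun s => Y s + Z s) = crossMoment P X Y + crossMoment P X Z := by
  ext i j
  simp only [crossMoment, Matrix.of_apply, Matrix.add_apply, Pi.add_apply, mul_add]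
  exact integral_add (integrable_apply_mul_apply hX hY i j) (integrable_apply_mul_apply hX hZ i j)

lemma crossMoment_mulVec_right {X : S → ι → ℝ} {Y : S → ι' → ℝ} (hX : MemLp X 2 P)
    (hY : MemLp Y 2 P) (W : Matrix ι'' ι' ℝ) :
    crossMoment P X (fun s => W *ᵥ Y s) = crossMoment P X Y * Wᵀ := by
  ext i j
  have hint (l : ι') : Integrable (fun s => X s i * Y s l * W j l) P :=
    (integrable_apply_mul_apply hX hY i l).mul_const _
  have hsum (s : S) : X s i * (W *ᵥ Y s) j = ∑ l, X s i * Y s l * W j l := by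
    rw [Matrix.mulVec, dotProduct, Finset.mul_sum]
    exact Finset.sum_congr rfl fun l _ => by ring
  simp only [crossMoment, Matrix.of_apply, Matrix.mul_apply, Matrix.transpose_apply, hsum]
  rw [integral_finsetSum _ fun l _ => hint l]
  simp only [integral_mul_const]

lemma integral_dotProduct_mulVec {X : S → ι → ℝ} {Y : S → ι' → ℝ} (hX : MemLp X 2 P)
    (hY : MemLp Y 2 P) (W : Matrix ι ι' ℝ) :
    ∫ s, X s ⬝ᵥ (W *ᵥ Y s) ∂P = (crossMoment P X Y * Wᵀ).trace := by
  rw [← crossMoment_mulVec_right hX hY]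
  exact integral_finsetSum _ fun i _ => integrable_apply_mul_apply hX (memLp_mulVec hY W) i i

lemma covMat_eq_crossMoment [IsProbabilityMeasure P] {n : ℕ} {X : S → Fin n → ℝ}
    (hX : MemLp X 2 P) (hX0 : ∫ s, X s ∂P = 0) : covMat P X = crossMoment P X X := by
  ext i j
  have hX0i : ∫ s, X s i ∂P = 0 := by
    rw [← eval_integral fun i => (hX.integrable one_le_two).eval i, hX0, Pi.zero_apply]
  simp only [covMat, crossMoment, Matrix.of_apply]
  rw [covariance_eq_sub (hX.eval i) (hX.eval j), hX0i, zero_mul, sub_zero]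
  rfl

lemma crossMoment_condExp [IsFiniteMeasure P] {m : MeasurableSpace S} (hm : m ≤ mS)
    {X : S → ι → ℝ} {Y : S → ι' → ℝ} (hX : MemLp X 2 P) (hY : MemLp Y 2 P)
    (hYm : Measurable[m] Y) : crossMoment P Y (P[X | m]) = crossMoment P Y X := by
  ext i j
  have hYi : StronglyMeasurable[m] fun s => Y s i :=
    ((measurable_pi_apply i).comp hYm).stronglyMeasurable
  have hXj : (fun s => P[X | m] s j) =ᵐ[P] P[fun s => X s j | m] :=
    (ContinuousLinearMap.proj (R := ℝ) (φ := fun _ : ι => ℝ) j).comp_condExp_comm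
      (hX.integrable one_le_two)
  simp only [crossMoment, Matrix.of_apply]
  rw [← integral_condExp hm (f := fun s => Y s i * X s j)]
  refine integral_congr_ae ?_
  filter_upwards [hXj, condExp_mul_of_stronglyMeasurable_left hYi
    (integrable_apply_mul_apply hY hX i j) ((hX.eval j).integrable one_le_two)] with s hs hmul
  rw [hs]
  exact hmul.symm

end SecondMoments

section QuadraticMoments

variable {S : Type*} {mS : MeasurableSpace S} {P : Measure S} {n l : ℕ}

lemma integrable_quad {X : S → Fin n → ℝ} (hX : MemLp X 2 P) (W : Matrix (Fin n) (Fin n) ℝ) :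
    Integrable (fun s => quad W (X s)) P :=
  integrable_dotProduct hX (memLp_mulVec hX W)

lemma lintegral_quad {X : S → Fin n → ℝ} (hX : MemLp X 2 P) {W : Matrix (Fin n) (Fin n) ℝ}
    (hW : W.PosSemidef) :
    ∫⁻ s, ENNReal.ofReal (quad W (X s)) ∂P = ENNReal.ofReal (∫ s, quad W (X s) ∂P) :=
  (ofReal_integral_eq_lintegral_ofReal (integrable_quad hX W)
    (.of_forall fun _ => quad_nonneg hW _)).symm

lemma integral_quad {X : S → Fin n → ℝ} (hX : MemLp X 2 P) (W : Matrix (Fin n) (Fin n) ℝ) :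
    ∫ s, quad W (X s) ∂P = (crossMoment P X X * W).trace := by
  rw [Matrix.trace_mul_comm, ← Matrix.trace_transpose, Matrix.transpose_mul, crossMoment_transpose]
  exact integral_dotProduct_mulVec hX hX W

lemma integral_quad_add_of_crossMoment_eq_zero {X Y : S → Fin n → ℝ} (hX : MemLp X 2 P)
    (hY : MemLp Y 2 P) (hXY : crossMoment P X Y = 0) (W : Matrix (Fin n) (Fin n) ℝ) :
    ∫ s, quad W (X s + Y s) ∂P = ∫ s, quad W (X s) ∂P + ∫ s, quad W (Y s) ∂P := by
  have hYX : crossMoment P Y X = 0 := by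
    rw [← crossMoment_transpose, hXY, Matrix.transpose_zero]
  have hadd : MemLp (fun s => X s + Y s) 2 P := hX.add hY
  have hsum : crossMoment P (fun s => X s + Y s) (fun s => X s + Y s)
      = crossMoment P X X + crossMoment P Y Y := by
    rw [crossMoment_add_right hadd hX hY, ← crossMoment_transpose X,
      ← crossMoment_transpose Y, crossMoment_add_right hX hX hY, crossMoment_add_right hY hX hY,
      hXY, hYX, add_zero, zero_add, crossMoment_transpose, crossMoment_transpose]
  rw [integral_quad hadd, integral_quad hX, integral_quad hY, hsum, Matrix.add_mul,
    Matrix.trace_add]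

lemma integral_quad_add_mulVec [IsFiniteMeasure P] {m : MeasurableSpace S} (hm : m ≤ mS)
    {X : S → Fin l → ℝ} {Y : S → Fin n → ℝ} (hX : MemLp X 2 P) (hY : MemLp Y 2 P)
    (hYm : Measurable[m] Y) (W : Matrix (Fin n) (Fin n) ℝ) (F : Matrix (Fin n) (Fin l) ℝ) :
    ∫ s, quad W (Y s + F *ᵥ X s) ∂P =
      ∫ s, quad W (Y s + F *ᵥ P[X | m] s) ∂P + ∫ s, quad W (F *ᵥ (X s - P[X | m] s)) ∂P := by
  have hE : MemLp (P[X | m]) 2 P := hX.condExp one_le_two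
  have hD : MemLp (fun s => X s - P[X | m] s) 2 P := hX.sub hE
  have hZ : MemLp (fun s => Y s + F *ᵥ P[X | m] s) 2 P := hY.add (memLp_mulVec hE F)
  have hZm : Measurable[m] fun s => Y s + F *ᵥ P[X | m] s :=
    hYm.add (measurable_mulVec stronglyMeasurable_condExp.measurable F)
  have horth : crossMoment P (fun s => Y s + F *ᵥ P[X | m] s) (fun s => X s - P[X | m] s) = 0 := by
    have h := crossMoment_add_right hZ hD hE
    simpa [crossMoment_condExp hm hX hZ hZm] using h
  rw [← integral_quad_add_of_crossMoment_eq_zero hZ (memLp_mulVec hD F)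
    ((crossMoment_mulVec_right hZ hD F).trans (by simp [horth]))]
  simp [Matrix.mulVec_sub]

lemma integral_quad_mulVec_eq_add [IsFiniteMeasure P] {m : MeasurableSpace S} (hm : m ≤ mS)
    {X : S → Fin l → ℝ} (hX : MemLp X 2 P) (W : Matrix (Fin n) (Fin n) ℝ)
    (F : Matrix (Fin n) (Fin l) ℝ) :
    ∫ s, quad W (F *ᵥ X s) ∂P =
      ∫ s, quad W (F *ᵥ P[X | m] s) ∂P + ∫ s, quad W (F *ᵥ (X s - P[X | m] s)) ∂P := by
  simpa only [Pi.zero_apply, zero_add] using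
    integral_quad_add_mulVec hm hX (MemLp.zero (ε := Fin n → ℝ)) measurable_const W F

open scoped MatrixOrder Matrix.Norms.L2Operator in
lemma memLp_of_lintegral_quad_lt_top {W : Matrix (Fin n) (Fin n) ℝ} (hW : W.PosDef)
    {X : S → Fin n → ℝ} (hX : Measurable X)
    (h : ∫⁻ s, ENNReal.ofReal (quad W (X s)) ∂P < ∞) : MemLp X 2 P := by
  obtain ⟨U, hU⟩ := CStarAlgebra.nonneg_iff_eq_star_mul_self.mp hW.posSemidef.nonneg
  have hdet : IsUnit U.det := by
    have := hW.det_pos.ne'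
    rw [hU, Matrix.det_mul] at this
    exact (right_ne_zero_of_mul this).isUnit
  have hquad (x : Fin n → ℝ) : quad W x = ∑ i, (U *ᵥ x) i ^ 2 := by
    rw [hU, ← mul_one (star U), Matrix.star_eq_conjTranspose,
      Matrix.conjTranspose_eq_transpose_of_trivial, ← quad_mulVec, quad, Matrix.one_mulVec]
    simp only [dotProduct, sq]
  have hUX : MemLp (fun s => U *ᵥ X s) 2 P := MemLp.of_eval fun i => by
    have hmeas : Measurable fun s => (U *ᵥ X s) i :=
      (measurable_pi_apply i).comp (measurable_mulVec hX U)
    refine (memLp_two_iff_integrable_sq hmeas.aestronglyMeasurable).2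
      ⟨(hmeas.pow_const 2).aestronglyMeasurable, ?_⟩
    rw [hasFiniteIntegral_iff_ofReal (.of_forall fun s => sq_nonneg _)]
    refine (lintegral_mono fun s => ENNReal.ofReal_le_ofReal ?_).trans_lt h
    rw [hquad]
    exact Finset.single_le_sum (f := fun i => (U *ᵥ X s) i ^ 2) (fun i _ => sq_nonneg _)
      (Finset.mem_univ i)
  simpa only [Matrix.mulVec_mulVec, Matrix.nonsing_inv_mul U hdet, Matrix.one_mulVec]
    using memLp_mulVec hUX U⁻¹

end QuadraticMoments

section Gaussian

variable {S : Type*} [MeasurableSpace S] {P : Measure S} {ι : Type*} [Fintype ι] [DecidableEq ι]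
  {X : S → ι → ℝ} {C : Matrix ι ι ℝ}

lemma memLp_of_hasLaw_multivariateGaussian {μ : EuclideanSpace ℝ ι}
    (h : HasLaw (fun s => WithLp.toLp 2 (X s)) (multivariateGaussian μ C) P) : MemLp X 2 P := by
  have hid : MemLp (id : EuclideanSpace ℝ ι → _) 2 (P.map fun s => WithLp.toLp 2 (X s)) := by
    rw [h.map_eq]
    exact IsGaussian.memLp_two_id
  exact MemLp.of_eval ((memLp_map_measure_iff hid.1 h.aemeasurable).1 hid).eval_piLp

lemma integral_of_hasLaw_multivariateGaussian {μ : EuclideanSpace ℝ ι}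
    (h : HasLaw (fun s => WithLp.toLp 2 (X s)) (multivariateGaussian μ C) P) :
    ∫ s, X s ∂P = WithLp.ofLp μ := by
  have hlaw := h.integral_comp (f := WithLp.ofLp) (by fun_prop)
  have hlin := (PiLp.continuousLinearEquiv 2 ℝ fun _ : ι => ℝ).integral_comp_comm
    (id : EuclideanSpace ℝ ι → _) (μ := multivariateGaussian μ C)
  simp only [id, integral_id_multivariateGaussian] at hlin
  exact hlaw.trans hlin

lemma crossMoment_of_hasLaw_multivariateGaussian (hC : C.PosSemidef)
    (h : HasLaw (fun s => WithLp.toLp 2 (X s)) (multivariateGaussian 0 C) P) :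
    crossMoment P X X = C := by
  have : IsProbabilityMeasure P := h.isProbabilityMeasure
  have hX := memLp_of_hasLaw_multivariateGaussian h
  ext i j
  have hXi : ∫ s, X s i ∂P = 0 := by
    rw [← eval_integral fun i => (hX.integrable one_le_two).eval i,
      integral_of_hasLaw_multivariateGaussian h, WithLp.ofLp_zero, Pi.zero_apply]
  rw [← covariance_eval_multivariateGaussian (μ := 0) hC i j, ← h.map_eq,
    covariance_map (by fun_prop) (by fun_prop) h.aemeasurable]
  refine Eq.trans ?_ (covariance_eq_sub (hX.eval i) (hX.eval j)).symm
  rw [hXi, zero_mul, sub_zero]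
  rfl

end Gaussian

/-! ### Information carried by the signals -/

section Information

variable {κ m r : ℕ} {Ω : Type*} {M : Model κ m r Ω} {S : Type*} {mS : MeasurableSpace S}
  {P : Measure S}

/-- The contribution `∑_{j < t} A^{t-j-1} B u_j` of the controls `u` to the state with index `t`;
as for `Noise.state`, the index `t` is the time `t + 1`. -/
def Model.drift (M : Model κ m r Ω) (u : Fin κ → Fin r → ℝ) (t : Fin (κ + 1)) : Fin m → ℝ :=
  ∑ j : Fin κ with j.castSucc < t, (M.A ^ ((t : ℕ) - (j : ℕ) - 1) * M.B) *ᵥ u j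

lemma Model.drift_castSucc (u : Fin κ → Fin r → ℝ) (k : Fin κ) :
    M.drift u k.castSucc
      = ∑ j ∈ Finset.Iio k, (M.A ^ ((k : ℕ) - (j : ℕ) - 1) * M.B) *ᵥ u j :=
  Finset.sum_congr (by ext j; simp) fun _ _ => rfl

lemma Model.drift_succ_eq_sum_Iic (u : Fin κ → Fin r → ℝ) (k : Fin κ) :
    M.drift u k.succ = ∑ j ∈ Finset.Iic k, (M.A ^ ((k : ℕ) - (j : ℕ)) * M.B) *ᵥ u j := by
  refine Finset.sum_congr (by ext j; simp [Fin.castSucc_lt_succ_iff]) fun j _ => ?_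
  rw [Fin.val_succ, Nat.sub_right_comm, Nat.add_sub_cancel]

lemma Model.drift_succ (u : Fin κ → Fin r → ℝ) (k : Fin κ) :
    M.drift u k.succ = M.A *ᵥ M.drift u k.castSucc + M.B *ᵥ u k := by
  rw [M.drift_succ_eq_sum_Iic, M.drift_castSucc, ← Finset.Iio_insert,
    Finset.sum_insert Finset.notMem_Iio_self, Nat.sub_self, pow_zero, Matrix.one_mul, add_comm,
    Matrix.mulVec_sum]
  refine congrArg (· + _) (Finset.sum_congr rfl fun j hj => ?_)
  have hjk : (k : ℕ) - j = (k : ℕ) - j - 1 + 1 := by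
    have := Fin.lt_def.1 (Finset.mem_Iio.1 hj)
    omega
  rw [Matrix.mulVec_mulVec, ← Matrix.mul_assoc, ← pow_succ', ← hjk]

lemma Model.drift_congr {u u' : Fin κ → Fin r → ℝ} {t : Fin (κ + 1)}
    (h : ∀ j : Fin κ, j.castSucc < t → u j = u' j) : M.drift u t = M.drift u' t :=
  Finset.sum_congr rfl fun j hj => by rw [h j (Finset.mem_filter.1 hj).2]

lemma Model.measurable_drift {_ : MeasurableSpace S} {u : Fin κ → S → Fin r → ℝ}
    {t : Fin (κ + 1)} (hu : ∀ j : Fin κ, j.castSucc < t → Measurable (u j)) :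
    Measurable fun s => M.drift (fun j => u j s) t :=
  Finset.measurable_sum _ fun j hj => measurable_mulVec (hu j (Finset.mem_filter.1 hj).2) _

/-- The contribution of the controls `u` to the signal at stage `k`. -/
def Model.signalShift (M : Model κ m r Ω) (η : Signaling κ m) (k : Fin κ)
    (u : Fin κ → Fin r → ℝ) : Fin m → ℝ :=
  ∑ i : Finset.Iic k, (η.gain k i)ᵀ *ᵥ M.drift u i.1.castSucc

lemma Model.signalShift_congr (η : Signaling κ m) {k : Fin κ} {u u' : Fin κ → Fin r → ℝ}
    (h : ∀ j < k, u j = u' j) : M.signalShift η k u = M.signalShift η k u' :=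
  Finset.sum_congr rfl fun i _ => by
    rw [M.drift_congr fun j hj => h j
      ((Fin.castSucc_lt_castSucc_iff.1 hj).trans_le (Finset.mem_Iic.1 i.2))]

lemma Model.measurable_signalShift {_ : MeasurableSpace S} (η : Signaling κ m) {k : Fin κ}
    {u : Fin κ → S → Fin r → ℝ} (hu : ∀ j < k, Measurable (u j)) :
    Measurable fun s => M.signalShift η k fun j => u j s :=
  Finset.measurable_sum _ fun i _ => measurable_mulVec (Model.measurable_drift fun j hj => hu j
    ((Fin.castSucc_lt_castSucc_iff.1 hj).trans_le (Finset.mem_Iic.1 i.2))) _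

variable (N : Noise M P) (η : Signaling κ m) (γ : Policy κ m r)

lemma Noise.state_zero (s : S) : N.state η γ 0 s = N.x₁ s := by
  rw [Noise.state.eq_def]
  rfl

lemma Noise.state_succ (k : Fin κ) (s : S) :
    N.state η γ k.succ s
      = M.A *ᵥ N.state η γ k.castSucc s + M.B *ᵥ N.control η γ k s + N.w k s := by
  rw [Noise.state.eq_def]
  rfl

lemma Noise.freeState_zero (s : S) : N.freeState 0 s = N.x₁ s := by
  rw [Noise.freeState.eq_def]
  rfl

lemma Noise.freeState_succ (k : Fin κ) (s : S) :
    N.freeState k.succ s = M.A *ᵥ N.freeState k.castSucc s + N.w k s := by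
  rw [Noise.freeState.eq_def]
  rfl

lemma Noise.state_eq_freeState_add_drift (t : Fin (κ + 1)) (s : S) :
    N.state η γ t s = N.freeState t s + M.drift (fun j => N.control η γ j s) t := by
  induction t using Fin.induction with
  | zero => simp [N.state_zero, N.freeState_zero, Model.drift]
  | succ k ih =>
    rw [N.state_succ, ih, N.freeState_succ, M.drift_succ, Matrix.mulVec_add]
    abel

/-- The control-free signal at stage `k`. -/
def Noise.freeSignal (k : Fin κ) (s : S) : Fin m → ℝ :=
  ∑ i : Finset.Iic k, (η.gain k i)ᵀ *ᵥ N.freeState i.1.castSucc s + N.v η k s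

lemma Noise.signal_eq_freeSignal_add (k : Fin κ) (s : S) :
    N.signal η γ k s
      = N.freeSignal η k s + M.signalShift η k fun j => N.control η γ j s := by
  simp only [Noise.signal, Noise.freeSignal, Model.signalShift, N.state_eq_freeState_add_drift,
    Matrix.mulVec_add, Finset.sum_add_distrib]
  abel

/-- The information available at stage `k`; it is the same for all control policies by
`Noise.comap_signals_eq_info`. -/
abbrev Noise.info (k : Fin κ) : MeasurableSpace S :=
  MeasurableSpace.comap (N.freeSignals η k) inferInstance

lemma Noise.measurable_freeSignal_info {j k : Fin κ} (h : j ≤ k) :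
    Measurable[N.info η k] (N.freeSignal η j) :=
  (measurable_pi_apply (⟨j, Finset.mem_Iic.2 h⟩ : Finset.Iic k)).comp
    (comap_measurable (N.freeSignals η k))

lemma Noise.info_mono : Monotone (N.info η) := fun _ _ h =>
  (measurable_of_forall_apply fun i =>
    N.measurable_freeSignal_info η ((Finset.mem_Iic.1 i.2).trans h)).comap_le

lemma Noise.measurable_signals_info (k : Fin κ) :
    Measurable[N.info η k] (N.signals η γ k) := by
  induction k using WellFoundedLT.induction with
  | ind k ih =>
    refine measurable_of_forall_apply fun i => ?_
    have hi := Finset.mem_Iic.1 i.2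
    simp only [Noise.signals, N.signal_eq_freeSignal_add]
    refine (N.measurable_freeSignal_info η hi).add (Model.measurable_signalShift η fun j hj => ?_)
    have hjk := hj.trans_le hi
    exact ((γ.measurable_act j).comp (ih j hjk)).mono (N.info_mono η hjk.le) le_rfl

lemma Noise.measurable_control_info {j k : Fin κ} (h : j ≤ k) :
    Measurable[N.info η k] (N.control η γ j) :=
  ((γ.measurable_act j).comp (N.measurable_signals_info η γ j)).mono (N.info_mono η h) le_rfl

lemma Noise.comap_signals_eq_info (k : Fin κ) :
    MeasurableSpace.comap (N.signals η γ k) inferInstance = N.info η k := by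
  refine le_antisymm (N.measurable_signals_info η γ k).comap_le ?_
  have hsignal : ∀ j ≤ k, Measurable[MeasurableSpace.comap (N.signals η γ k) inferInstance]
      (N.signal η γ j) := fun j hj =>
    (measurable_pi_apply (⟨j, Finset.mem_Iic.2 hj⟩ : Finset.Iic k)).comp
      (comap_measurable (N.signals η γ k))
  have hcontrol : ∀ j ≤ k, Measurable[MeasurableSpace.comap (N.signals η γ k) inferInstance]
      (N.control η γ j) := fun j hj =>
    (γ.measurable_act j).comp (measurable_of_forall_apply fun i =>
      hsignal i.1 ((Finset.mem_Iic.1 i.2).trans hj))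
  refine Measurable.comap_le (measurable_of_forall_apply fun i => ?_)
  have hi := Finset.mem_Iic.1 i.2
  have hfree : (fun s => N.freeSignals η k s i)
      = fun s => N.signal η γ i.1 s - M.signalShift η i.1 fun j => N.control η γ j s :=
    funext fun s => by rw [N.signal_eq_freeSignal_add, add_sub_cancel_right]; rfl
  rw [hfree]
  exact (hsignal i.1 hi).sub
    (Model.measurable_signalShift η fun j hj => hcontrol j (hj.le.trans hi))

/-- The posterior estimate `E{x°_k | s_{1:k}}` as a function of the signaling rule alone. -/
def Noise.freePosterior (k : Fin κ) : S → Fin m → ℝ :=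
  P[N.freeState k.castSucc | N.info η k]

lemma Noise.posterior_eq_freePosterior (k : Fin κ) :
    N.posterior η γ k = N.freePosterior η k := by
  rw [Noise.posterior, N.comap_signals_eq_info, Noise.freePosterior]

lemma Noise.posteriorCov_eq_H (k : Fin κ) : N.posteriorCov η γ k = N.H η k := by
  rw [Noise.posteriorCov, N.posterior_eq_freePosterior]
  rfl

lemma Noise.measurable_freePosterior_info {j k : Fin κ} (h : j ≤ k) :
    Measurable[N.info η k] (N.freePosterior η j) :=
  stronglyMeasurable_condExp.measurable.mono (N.info_mono η h) le_rfl

end Information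

/-! ### Independence of the state noise from the past -/

section Past

variable {κ m r : ℕ} {Ω : Type*} {M : Model κ m r Ω} {S : Type*} {mS : MeasurableSpace S}
  {P : Measure S} (N : Noise M P) (η : Signaling κ m)

/-- The primitive random vectors, as one family. -/
def Noise.primitive : Unit ⊕ (Fin κ ⊕ Fin κ) → S → Fin m → ℝ :=
  Sum.elim (fun _ : Unit => N.x₁) (Sum.elim N.w (N.v η))

lemma Noise.measurable_primitive (i : Unit ⊕ (Fin κ ⊕ Fin κ)) :
    Measurable (N.primitive η i) := by
  rcases i with _ | i | i
  exacts [N.measurable_x₁, N.measurable_w i, N.measurable_v η i]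

/-- The indices of the primitive random vectors other than the state noise from stage `k` on. -/
def pastIndex (k : Fin κ) : Set (Unit ⊕ (Fin κ ⊕ Fin κ)) :=
  {i | ∀ l, k ≤ l → i ≠ Sum.inr (Sum.inl l)}

/-- The information carried by everything but the state noise from stage `k` on. It contains all
the signaling noise, which is harmless and makes it independent of the control policy. -/
abbrev Noise.past (k : Fin κ) : MeasurableSpace S :=
  ⨆ i ∈ pastIndex k, MeasurableSpace.comap (N.primitive η i) inferInstance

lemma Noise.past_le (k : Fin κ) : N.past η k ≤ mS :=
  iSup₂_le fun i _ => (N.measurable_primitive η i).comap_le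

lemma Noise.past_mono : Monotone (N.past η) := fun _ _ h =>
  biSup_mono fun _ hi l hl => hi l (h.trans hl)

lemma Noise.measurable_primitive_past {k : Fin κ} {i : Unit ⊕ (Fin κ ⊕ Fin κ)}
    (hi : i ∈ pastIndex k) : Measurable[N.past η k] (N.primitive η i) :=
  (comap_measurable (N.primitive η i)).mono
    (le_iSup₂_of_le (f := fun i (_ : i ∈ pastIndex k) =>
      MeasurableSpace.comap (N.primitive η i) inferInstance) i hi le_rfl) le_rfl

lemma Noise.measurable_freeState_past {k : Fin κ} {t : Fin (κ + 1)} (h : t ≤ k.castSucc) :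
    Measurable[N.past η k] (N.freeState t) := by
  induction t using Fin.induction with
  | zero =>
    have hx : N.freeState 0 = N.primitive η (Sum.inl ()) := funext N.freeState_zero
    rw [hx]
    exact N.measurable_primitive_past η fun l _ => by simp
  | succ j ih =>
    have hjk : j < k := Fin.succ_le_castSucc_iff.1 h
    rw [funext (N.freeState_succ j)]
    refine (measurable_mulVec (ih (Fin.castSucc_le_castSucc_iff.2 hjk.le)) _).add
      (N.measurable_primitive_past η (i := Sum.inr (Sum.inl j)) fun l hl hjl => ?_)
    exact (hjk.trans_le hl).ne (Sum.inl_injective (Sum.inr_injective hjl))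

lemma Noise.info_le_past (k : Fin κ) : N.info η k ≤ N.past η k := by
  refine Measurable.comap_le (measurable_of_forall_apply fun i => ?_)
  refine (Finset.measurable_sum _ fun l _ => measurable_mulVec
    (N.measurable_freeState_past η (Fin.castSucc_le_castSucc_iff.2 ?_)) _).add
    (N.measurable_primitive_past η (i := Sum.inr (Sum.inr i.1)) fun l _ => by simp)
  exact (Finset.mem_Iic.1 l.2).trans (Finset.mem_Iic.1 i.2)

lemma Noise.info_le (k : Fin κ) : N.info η k ≤ mS :=
  (N.info_le_past η k).trans (N.past_le η k)

lemma Noise.measurable_control (γ : Policy κ m r) (k : Fin κ) : Measurable (N.control η γ k) :=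
  (N.measurable_control_info η γ le_rfl).mono (N.info_le η k) le_rfl

lemma Noise.measurable_state_past (γ : Policy κ m r) (k : Fin κ) :
    Measurable[N.past η k] (N.state η γ k.castSucc) := by
  rw [funext (N.state_eq_freeState_add_drift η γ k.castSucc)]
  refine (N.measurable_freeState_past η le_rfl).add (Model.measurable_drift fun j hj => ?_)
  exact (N.measurable_control_info η γ (Fin.castSucc_lt_castSucc_iff.1 hj).le).mono
    (N.info_le_past η k) le_rfl

lemma Noise.indepFun_noise {β : Type*} {mβ : MeasurableSpace β} (k : Fin κ) {Y : S → β}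
    (hY : Measurable[N.past η k] Y) : IndepFun Y (N.w k) P := by
  have h : Indep (N.past η k)
      (⨆ i ∈ ({Sum.inr (Sum.inl k)} : Set (Unit ⊕ (Fin κ ⊕ Fin κ))),
        MeasurableSpace.comap (N.primitive η i) inferInstance) P :=
    indep_iSup_of_disjoint (fun i => (N.measurable_primitive η i).comap_le) (N.indep η)
      (Set.disjoint_singleton_right.2 fun h => h k le_rfl rfl)
  simp only [Set.mem_singleton_iff, iSup_iSup_eq_left] at h
  exact (IndepFun_iff_Indep _ _ _).2 (indep_of_indep_of_le_left h hY.comap_le)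

end Past

/-! ### Second moments of the control-free state and of its estimates -/

section ModelMoments

variable {κ m r : ℕ} {Ω : Type*} {M : Model κ m r Ω} {S : Type*} {mS : MeasurableSpace S}
  {P : Measure S} (N : Noise M P) (η : Signaling κ m)

/-- The random vector that stacks the vectors `X k` of all stages, indexed like the rows of the
block matrices. -/
abbrev stack {n : ℕ} (X : Fin κ → S → Fin n → ℝ) (s : S) : Fin κ × Fin n → ℝ :=
  Function.uncurry fun k => X k s

lemma memLp_stack {n : ℕ} {X : Fin κ → S → Fin n → ℝ} (hX : ∀ k, MemLp (X k) 2 P) :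
    MemLp (stack X) 2 P :=
  MemLp.of_eval fun p => (hX p.1).eval p.2

lemma Noise.memLp_w (k : Fin κ) : MemLp (N.w k) 2 P :=
  memLp_of_hasLaw_multivariateGaussian (N.law_w k)

lemma Noise.integral_w (k : Fin κ) : ∫ s, N.w k s ∂P = 0 :=
  integral_of_hasLaw_multivariateGaussian (N.law_w k)

lemma Noise.memLp_freeState (t : Fin (κ + 1)) : MemLp (N.freeState t) 2 P := by
  induction t using Fin.induction with
  | zero =>
    rw [funext N.freeState_zero]
    exact memLp_of_hasLaw_multivariateGaussian N.law_x₁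
  | succ k ih =>
    rw [funext (N.freeState_succ k)]
    exact (memLp_mulVec ih M.A).add (N.memLp_w k)

lemma Noise.crossMoment_w_eq_zero [IsFiniteMeasure P] {k : Fin κ} {l : ℕ} {Y : S → Fin l → ℝ}
    (hY : Measurable[N.past η k] Y) : crossMoment P Y (N.w k) = 0 :=
  crossMoment_eq_zero_of_indepFun (hY.mono (N.past_le η k) le_rfl).aestronglyMeasurable
    ((N.memLp_w k).integrable one_le_two) (N.indepFun_noise η k hY) (N.integral_w k)

lemma Noise.integral_quad_add_w [IsFiniteMeasure P] {k : Fin κ} {Y : S → Fin m → ℝ}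
    (hY : MemLp Y 2 P) (hYm : Measurable[N.past η k] Y) (W : Matrix (Fin m) (Fin m) ℝ) :
    ∫ s, quad W (Y s + N.w k s) ∂P = ∫ s, quad W (Y s) ∂P + (M.covNoise * W).trace := by
  rw [integral_quad_add_of_crossMoment_eq_zero hY (N.memLp_w k) (N.crossMoment_w_eq_zero η hYm),
    integral_quad (N.memLp_w k),
    crossMoment_of_hasLaw_multivariateGaussian M.covNoise_posSemidef (N.law_w k)]

lemma Noise.crossMoment_freeState_succ [IsFiniteMeasure P] {k : Fin κ} {n : ℕ} {Y : S → Fin n → ℝ}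
    (hY : MemLp Y 2 P) (hYm : Measurable[N.past η k] Y) :
    crossMoment P Y (N.freeState k.succ) = crossMoment P Y (N.freeState k.castSucc) * M.Aᵀ := by
  have hx := N.memLp_freeState k.castSucc
  rw [funext (N.freeState_succ k), crossMoment_add_right hY (memLp_mulVec hx M.A) (N.memLp_w k),
    crossMoment_mulVec_right hY hx, N.crossMoment_w_eq_zero η hYm, add_zero]

lemma Noise.crossMoment_freeState [IsFiniteMeasure P] {k l : Fin κ} (hkl : k ≤ l) {n : ℕ}
    {Y : S → Fin n → ℝ} (hY : MemLp Y 2 P) (hYm : Measurable[N.past η k] Y) :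
    crossMoment P Y (N.freeState l.castSucc)
      = crossMoment P Y (N.freeState k.castSucc) * (M.A ^ ((l : ℕ) - (k : ℕ)))ᵀ := by
  suffices h : ∀ t : Fin (κ + 1), k.castSucc ≤ t → crossMoment P Y (N.freeState t)
      = crossMoment P Y (N.freeState k.castSucc) * (M.A ^ ((t : ℕ) - (k : ℕ)))ᵀ from
    h l.castSucc (Fin.castSucc_le_castSucc_iff.2 hkl)
  intro t
  induction t using Fin.induction with
  | zero =>
    intro hk
    have hk0 : k.castSucc = 0 := Fin.le_zero_iff.1 hk
    simp [hk0]
  | succ j ih =>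
    intro hk
    obtain hk | hk := hk.lt_or_eq
    · have hkj : k ≤ j := Fin.castSucc_lt_succ_iff.1 hk
      have hpow : (j.succ : ℕ) - k = j.castSucc - k + 1 := Nat.succ_sub hkj
      rw [N.crossMoment_freeState_succ η hY (hYm.mono (N.past_mono η hkj) le_rfl),
        ih (Fin.castSucc_le_castSucc_iff.2 hkj), hpow, pow_succ', Matrix.transpose_mul,
        Matrix.mul_assoc]
    · simp [← hk]

lemma Noise.memLp_freePosterior (k : Fin κ) : MemLp (N.freePosterior η k) 2 P :=
  (N.memLp_freeState k.castSucc).condExp one_le_two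

lemma Noise.freeCov_eq_crossMoment :
    N.freeCov = crossMoment P (stack fun k => N.freeState k.castSucc)
      (stack fun k => N.freeState k.castSucc) := rfl

variable [IsProbabilityMeasure P]

lemma Noise.integral_freeState (t : Fin (κ + 1)) : ∫ s, N.freeState t s ∂P = 0 := by
  induction t using Fin.induction with
  | zero =>
    rw [funext N.freeState_zero]
    exact integral_of_hasLaw_multivariateGaussian N.law_x₁
  | succ k ih =>
    have hx := (N.memLp_freeState k.castSucc).integrable one_le_two
    rw [funext (N.freeState_succ k), integral_add ((memLp_mulVec
      (N.memLp_freeState k.castSucc) M.A).integrable one_le_two)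
      ((N.memLp_w k).integrable one_le_two), integral_mulVec hx, ih, N.integral_w,
      Matrix.mulVec_zero, add_zero]

lemma Noise.H_eq_crossMoment (k : Fin κ) :
    N.H η k = crossMoment P (N.freePosterior η k) (N.freePosterior η k) :=
  covMat_eq_crossMoment (N.memLp_freePosterior η k)
    ((integral_condExp (N.info_le η k)).trans (N.integral_freeState k.castSucc))

lemma Noise.crossMoment_freePosterior {k l : Fin κ} (hkl : k ≤ l) :
    crossMoment P (N.freePosterior η k) (N.freePosterior η l)
      = N.H η k * (M.A ^ ((l : ℕ) - (k : ℕ)))ᵀ := by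
  have hk := N.memLp_freePosterior η k
  have hpost {j : Fin κ} (hkj : k ≤ j) :
      crossMoment P (N.freePosterior η k) (N.freePosterior η j)
        = crossMoment P (N.freePosterior η k) (N.freeState j.castSucc) :=
    crossMoment_condExp (N.info_le η j) (N.memLp_freeState j.castSucc) hk
      (N.measurable_freePosterior_info η hkj)
  rw [hpost hkl, N.crossMoment_freeState η hkl hk
    ((N.measurable_freePosterior_info η le_rfl).mono (N.info_le_past η k) le_rfl),
    ← hpost le_rfl, N.H_eq_crossMoment]

lemma Noise.integral_dotProduct_V_mulVec (ω : Option Ω) :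
    ∫ s, stack (N.freePosterior η) s ⬝ᵥ (M.V ω *ᵥ stack (N.freePosterior η) s) ∂P
      = ∑ k, (N.H η k * M.Xi ω k).trace := by
  have hp := memLp_stack (N.memLp_freePosterior η)
  rw [integral_dotProduct_mulVec hp hp, (M.V_isSymm ω).eq]
  exact M.trace_mul_V (crossMoment_transpose (P := P) (stack (N.freePosterior η)) _)
    (fun k l hkl => N.crossMoment_freePosterior η hkl) ω

end ModelMoments

/-! ### The objectives of the controllers -/

section Controller

variable {κ m r : ℕ} {Ω : Type*} {M : Model κ m r Ω} {S : Type*} {mS : MeasurableSpace S}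
  {P : Measure S} (N : Noise M P) {ω : Option Ω} {η : Signaling κ m} {γ : Policy κ m r}

lemma Noise.freeControl_eq_control_add (k : Fin κ) (s : S) :
    N.freeControl ω η γ k s = N.control η γ k s
      + M.K ω k *ᵥ M.drift (fun j => N.control η γ j s) k.castSucc := by
  simp only [Noise.freeControl, M.drift_castSucc, Matrix.mulVec_sum, Matrix.mulVec_mulVec,
    Matrix.mul_assoc]

lemma Noise.control_add_mulVec_state (k : Fin κ) (s : S) :
    N.control η γ k s + M.K ω k *ᵥ N.state η γ k.castSucc s
      = N.freeControl ω η γ k s + M.K ω k *ᵥ N.freeState k.castSucc s := by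
  rw [N.state_eq_freeState_add_drift, N.freeControl_eq_control_add, Matrix.mulVec_add]
  abel

lemma Noise.measurable_freeControl_info (k : Fin κ) :
    Measurable[N.info η k] (N.freeControl ω η γ k) :=
  (N.measurable_control_info η γ le_rfl).add (Finset.measurable_sum _ fun _ hj =>
    measurable_mulVec (N.measurable_control_info η γ (Finset.mem_Iio.1 hj).le) _)

lemma Noise.memLp_freeControl (hu : ∀ k, MemLp (N.control η γ k) 2 P) (k : Fin κ) :
    MemLp (N.freeControl ω η γ k) 2 P :=
  (hu k).add (memLp_finsetSum _ fun j _ => memLp_mulVec (hu j) _)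

lemma Noise.memLp_control_of_freeControl (h : ∀ k, MemLp (N.freeControl ω η γ k) 2 P)
    (k : Fin κ) : MemLp (N.control η γ k) 2 P := by
  induction k using WellFoundedLT.induction with
  | ind k ih =>
    have hsum : MemLp (fun s => ∑ j ∈ Finset.Iio k,
        (M.K ω k * M.A ^ ((k : ℕ) - (j : ℕ) - 1) * M.B) *ᵥ N.control η γ j s) 2 P :=
      memLp_finsetSum _ fun j hj => memLp_mulVec (ih j (Finset.mem_Iio.1 hj)) _
    exact (memLp_congr_ae (.of_forall fun s => add_sub_cancel_right _ _)).1 ((h k).sub hsum)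

lemma Noise.memLp_drift (hu : ∀ k, MemLp (N.control η γ k) 2 P) (t : Fin (κ + 1)) :
    MemLp (fun s => M.drift (fun j => N.control η γ j s) t) 2 P :=
  memLp_finsetSum _ fun j _ => memLp_mulVec (hu j) _

lemma Noise.memLp_state (hu : ∀ k, MemLp (N.control η γ k) 2 P) (t : Fin (κ + 1)) :
    MemLp (N.state η γ t) 2 P := by
  rw [funext (N.state_eq_freeState_add_drift η γ t)]
  exact (N.memLp_freeState t).add (N.memLp_drift hu t)

lemma Noise.memLp_control_of_controllerCost_lt_top (h : N.controllerCost ω η γ < ∞)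
    (k : Fin κ) : MemLp (N.control η γ k) 2 P :=
  memLp_of_lintegral_quad_lt_top (M.R_posDef ω) (N.measurable_control η γ k)
    (ENNReal.add_lt_top.1 (ENNReal.sum_lt_top.1 h k (Finset.mem_univ k))).2

lemma Noise.controllerCost_eq_ofReal (hu : ∀ k, MemLp (N.control η γ k) 2 P) :
    N.controllerCost ω η γ = ENNReal.ofReal (∑ k : Fin κ,
      (∫ s, quad (M.Q ω) (N.state η γ k.succ s) ∂P
        + ∫ s, quad (M.R ω) (N.control η γ k s) ∂P)) := by
  have hQ (k : Fin κ) : 0 ≤ ∫ s, quad (M.Q ω) (N.state η γ k.succ s) ∂P :=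
    integral_nonneg fun _ => quad_nonneg (M.Q_posSemidef ω) _
  have hR (k : Fin κ) : 0 ≤ ∫ s, quad (M.R ω) (N.control η γ k s) ∂P :=
    integral_nonneg fun _ => quad_nonneg (M.R_posDef ω).posSemidef _
  rw [ENNReal.ofReal_sum_of_nonneg fun k _ => add_nonneg (hQ k) (hR k)]
  refine Finset.sum_congr rfl fun k _ => ?_
  rw [lintegral_quad (N.memLp_state hu k.succ) (M.Q_posSemidef ω),
    lintegral_quad (hu k) (M.R_posDef ω).posSemidef, ENNReal.ofReal_add (hQ k) (hR k)]

/-- The loss of type `ω` at stage `k` that is due to imperfect knowledge of the state. -/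
def Noise.estimationLoss (N : Noise M P) (ω : Option Ω) (η : Signaling κ m) (k : Fin κ) : ℝ :=
  ∫ s, quad (M.Del ω k)
    (M.K ω k *ᵥ (N.freeState k.castSucc s - N.freePosterior η k s)) ∂P

/-- The loss of type `ω` at stage `k` from deviating from `u°_k = -K_k^ω E{x°_k | s_{1:k}}`. -/
def Noise.excess (N : Noise M P) (ω : Option Ω) (η : Signaling κ m) (γ : Policy κ m r)
    (k : Fin κ) : ℝ :=
  ∫ s, quad (M.Del ω k) (N.freeControl ω η γ k s + M.K ω k *ᵥ N.freePosterior η k s) ∂P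

/-- The least cost of type `ω` under the signaling rule `η`, by `Noise.ofReal_minCost_le` and
`Noise.IsFeedback.controllerCost_eq`. -/
def Noise.minCost (N : Noise M P) (ω : Option Ω) (η : Signaling κ m) : ℝ :=
  M.del0 ω + ∑ k, N.estimationLoss ω η k

lemma Noise.excess_nonneg (ω : Option Ω) (η : Signaling κ m) (γ : Policy κ m r) (k : Fin κ) :
    0 ≤ N.excess ω η γ k :=
  integral_nonneg fun _ => quad_nonneg (M.Del_posDef ω k).posSemidef _

lemma Noise.excess_eq_zero_iff (hu : ∀ k, MemLp (N.control η γ k) 2 P) (k : Fin κ) :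
    N.excess ω η γ k = 0 ↔
      N.freeControl ω η γ k =ᵐ[P] fun s => -(M.K ω k *ᵥ N.posterior η γ k s) := by
  have hY : MemLp (fun s => N.freeControl ω η γ k s + M.K ω k *ᵥ N.freePosterior η k s) 2 P :=
    (N.memLp_freeControl hu k).add (memLp_mulVec (N.memLp_freePosterior η k) _)
  rw [Noise.excess, integral_eq_zero_iff_of_nonneg
    (fun s => quad_nonneg (M.Del_posDef ω k).posSemidef _) (integrable_quad hY _),
    N.posterior_eq_freePosterior]
  refine Filter.eventually_congr (.of_forall fun s => ?_)
  exact (quad_eq_zero_iff (M.Del_posDef ω k)).trans eq_neg_iff_add_eq_zero.symm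

variable [IsProbabilityMeasure P]

lemma Noise.integral_quad_Del_eq_excess_add (hu : ∀ k, MemLp (N.control η γ k) 2 P)
    (k : Fin κ) :
    ∫ s, quad (M.Del ω k) (N.control η γ k s + M.K ω k *ᵥ N.state η γ k.castSucc s) ∂P
      = N.excess ω η γ k + N.estimationLoss ω η k := by
  simp only [N.control_add_mulVec_state]
  exact integral_quad_add_mulVec (N.info_le η k) (N.memLp_freeState k.castSucc)
    (N.memLp_freeControl hu k) (N.measurable_freeControl_info k) _ _

lemma Noise.integral_quad_Qt_add_quad_R (hu : ∀ k, MemLp (N.control η γ k) 2 P) (k : Fin κ) :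
    ∫ s, quad (M.Qt ω (k + 1)) (N.state η γ k.succ s) ∂P + ∫ s, quad (M.R ω) (N.control η γ k s) ∂P
      = ∫ s, quad (M.Qt ω k - M.Q ω) (N.state η γ k.castSucc s) ∂P
        + (N.excess ω η γ k + N.estimationLoss ω η k)
        + (M.Qt ω (k + 1) * M.covNoise).trace := by
  have hx := N.memLp_state hu k.castSucc
  have hxu : MemLp (fun s => M.A *ᵥ N.state η γ k.castSucc s + M.B *ᵥ N.control η γ k s) 2 P :=
    (memLp_mulVec hx M.A).add (memLp_mulVec (hu k) M.B)
  have hxum : Measurable[N.past η k]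
      fun s => M.A *ᵥ N.state η γ k.castSucc s + M.B *ᵥ N.control η γ k s :=
    (measurable_mulVec (N.measurable_state_past η γ k) _).add (measurable_mulVec
      ((N.measurable_control_info η γ le_rfl).mono (N.info_le_past η k) le_rfl) _)
  have hd : MemLp (fun s => N.control η γ k s + M.K ω k *ᵥ N.state η γ k.castSucc s) 2 P :=
    (hu k).add (memLp_mulVec hx _)
  simp only [N.state_succ]
  rw [N.integral_quad_add_w η hxu hxum, Matrix.trace_mul_comm, add_right_comm,
    ← integral_add (integrable_quad hxu _) (integrable_quad (hu k) _)]
  simp only [M.quad_Qt_add_quad_R]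
  rw [integral_add (integrable_quad hx _) (integrable_quad hd _),
    N.integral_quad_Del_eq_excess_add hu]

lemma Noise.sum_integral_quad_eq_minCost_add (hu : ∀ k, MemLp (N.control η γ k) 2 P) :
    ∑ k : Fin κ,
      (∫ s, quad (M.Q ω) (N.state η γ k.succ s) ∂P + ∫ s, quad (M.R ω) (N.control η γ k s) ∂P)
      = N.minCost ω η + ∑ k, N.excess ω η γ k := by
  -- The Riccati step trades `‖x_{k+1}‖²` in `Q̃_{k+1} - Q` for `‖x_k‖²` in `Q̃_k - Q`, so the sum
  -- over the stages telescopes down to `Q̃_{κ+1} - Q = 0`.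
  set g : Fin (κ + 1) → ℝ := fun t => ∫ s, quad (M.Qt ω t - M.Q ω) (N.state η γ t s) ∂P with hg
  have hg_succ (k : Fin κ) : g k.succ = ∫ s, quad (M.Qt ω (k + 1)) (N.state η γ k.succ s) ∂P
      - ∫ s, quad (M.Q ω) (N.state η γ k.succ s) ∂P := by
    simp only [hg, quad_sub_matrix, Fin.val_succ]
    exact integral_sub (integrable_quad (N.memLp_state hu _) _)
      (integrable_quad (N.memLp_state hu _) _)
  have hstage (k : Fin κ) : ∫ s, quad (M.Q ω) (N.state η γ k.succ s) ∂P
      + ∫ s, quad (M.R ω) (N.control η γ k s) ∂P = g k.castSucc - g k.succ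
        + (N.excess ω η γ k + N.estimationLoss ω η k) + (M.Qt ω (k + 1) * M.covNoise).trace := by
    have hk := N.integral_quad_Qt_add_quad_R hu k (ω := ω)
    have hg_cast : g k.castSucc
      = ∫ s, quad (M.Qt ω k - M.Q ω) (N.state η γ k.castSucc s) ∂P := rfl
    linarith [hg_succ k]
  have hg_last : g (Fin.last κ) = 0 := by
    simp [hg, M.Qt_last, quad]
  have hg_zero : g 0 = ((M.Qt ω 0 - M.Q ω) * M.covInit).trace := by
    simp only [hg, N.state_zero, Fin.val_zero]
    rw [integral_quad (memLp_of_hasLaw_multivariateGaussian N.law_x₁), Matrix.trace_mul_comm,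
      crossMoment_of_hasLaw_multivariateGaussian M.covInit_posSemidef N.law_x₁]
  have htelescope : ∑ k : Fin κ, (g k.castSucc - g k.succ) = g 0 - g (Fin.last κ) := by
    rw [Finset.sum_sub_distrib]
    linarith [Fin.sum_univ_succ g, Fin.sum_univ_castSucc g]
  simp only [hstage, Finset.sum_add_distrib, htelescope, hg_last, hg_zero, Noise.minCost,
    Model.del0]
  ring

lemma Noise.controllerCost_eq_ofReal_minCost_add (hu : ∀ k, MemLp (N.control η γ k) 2 P) :
    N.controllerCost ω η γ = ENNReal.ofReal (N.minCost ω η + ∑ k, N.excess ω η γ k) := by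
  rw [N.controllerCost_eq_ofReal hu, N.sum_integral_quad_eq_minCost_add hu]

end Controller

/-! ### Best responses -/

section BestResponse

variable {κ m r : ℕ} {Ω : Type*} {M : Model κ m r Ω} {S : Type*} {mS : MeasurableSpace S}
  {P : Measure S} (N : Noise M P)

lemma Noise.signals_congr (η : Signaling κ m) {γ γ' : Policy κ m r} {k : Fin κ}
    (h : ∀ j < k, γ.act j = γ'.act j) (s : S) : N.signals η γ k s = N.signals η γ' k s := by
  induction k using WellFoundedLT.induction with
  | ind k ih =>
    ext1 i
    have hi := Finset.mem_Iic.1 i.2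
    simp only [Noise.signals, N.signal_eq_freeSignal_add]
    rw [Model.signalShift_congr η fun j hj => ?_]
    have hjk := hj.trans_le hi
    rw [Noise.control, Noise.control, h j hjk, ih j hjk fun l hl => h l (hl.trans hjk)]

lemma Noise.exists_policy_control_eq (η : Signaling κ m) (γ : Policy κ m r) {k : Fin κ}
    {u : S → Fin r → ℝ} (hu : Measurable[N.info η k] u) :
    ∃ γ' : Policy κ m r,
      (∀ j < k, N.control η γ' j = N.control η γ j) ∧ N.control η γ' k = u := by
  rw [← N.comap_signals_eq_info η γ] at hu
  obtain ⟨act, hact, rfl⟩ := hu.exists_eq_measurable_comp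
  let γ' : Policy κ m r :=
    { act := Function.update γ.act k act
      measurable_act := fun j => by
        obtain rfl | hjk := eq_or_ne j k
        · rwa [Function.update_self]
        · rw [Function.update_of_ne hjk]
          exact γ.measurable_act j }
  have hγ' : ∀ j < k, γ'.act j = γ.act j := fun j hj => Function.update_of_ne hj.ne _ _
  refine ⟨γ', fun j hj => funext fun s => ?_, funext fun s => ?_⟩
  · rw [Noise.control, Noise.control, hγ' j hj,
      N.signals_congr η fun l hl => hγ' l (hl.trans hj)]
  · have hk : γ'.act k = act := Function.update_self _ _ _
    rw [Noise.control, hk, N.signals_congr η hγ', Function.comp_apply]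

/-- `γ` applies `u°_k = -K_k^ω E{x°_k | s_{1:k}}` almost surely at all stages. -/
def Noise.IsFeedback (N : Noise M P) (ω : Option Ω) (η : Signaling κ m) (γ : Policy κ m r) :
    Prop :=
  ∀ k, N.freeControl ω η γ k =ᵐ[P] fun s => -(M.K ω k *ᵥ N.posterior η γ k s)

lemma Noise.exists_isFeedback (ω : Option Ω) (η : Signaling κ m) :
    ∃ γ : Policy κ m r, N.IsFeedback ω η γ := by
  suffices h : ∀ t : Fin (κ + 1), ∃ γ : Policy κ m r, ∀ k : Fin κ, k.castSucc < t → ∀ s,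
      N.freeControl ω η γ k s = -(M.K ω k *ᵥ N.freePosterior η k s) by
    obtain ⟨γ, hγ⟩ := h (Fin.last κ)
    refine ⟨γ, fun k => .of_forall fun s => ?_⟩
    rw [hγ k (Fin.castSucc_lt_last k), N.posterior_eq_freePosterior]
  intro t
  induction t using Fin.induction with
  | zero => exact ⟨⟨fun _ _ => 0, fun _ => measurable_const⟩, fun k hk => absurd hk (by simp)⟩
  | succ i ih =>
    obtain ⟨γ, hγ⟩ := ih
    obtain ⟨γ', hlt, hi⟩ := N.exists_policy_control_eq η γ (k := i)
      (u := fun s => -(M.K ω i *ᵥ N.freePosterior η i s)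
        - M.K ω i *ᵥ M.drift (fun j => N.control η γ j s) i.castSucc)
      ((measurable_mulVec (N.measurable_freePosterior_info η le_rfl) _).neg.sub
        (measurable_mulVec (Model.measurable_drift fun j hj =>
          N.measurable_control_info η γ (Fin.castSucc_lt_castSucc_iff.1 hj).le) _))
    have hdrift (k : Fin κ) (hk : k ≤ i) (s : S) :
        M.drift (fun j => N.control η γ' j s) k.castSucc
          = M.drift (fun j => N.control η γ j s) k.castSucc :=
      Model.drift_congr fun j hj => by
        rw [hlt j ((Fin.castSucc_lt_castSucc_iff.1 hj).trans_le hk)]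
    refine ⟨γ', fun k hk s => ?_⟩
    obtain hki | rfl := (Fin.castSucc_lt_succ_iff.1 hk).lt_or_eq
    · rw [← hγ k (Fin.castSucc_lt_castSucc_iff.2 hki), N.freeControl_eq_control_add,
        N.freeControl_eq_control_add, hlt k hki, hdrift k hki.le]
    · rw [N.freeControl_eq_control_add, hi, hdrift k le_rfl, sub_add_cancel]

lemma Noise.IsFeedback.memLp_control {N : Noise M P} {ω : Option Ω} {η : Signaling κ m}
    {γ : Policy κ m r} (h : N.IsFeedback ω η γ) (k : Fin κ) : MemLp (N.control η γ k) 2 P := by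
  refine N.memLp_control_of_freeControl (ω := ω) (fun j => (memLp_congr_ae (h j)).2 ?_) k
  rw [N.posterior_eq_freePosterior]
  exact (memLp_mulVec (N.memLp_freePosterior η j) _).neg

lemma Noise.sum_excess_eq_zero_iff {ω : Option Ω} {η : Signaling κ m} {γ : Policy κ m r}
    (hu : ∀ k, MemLp (N.control η γ k) 2 P) :
    ∑ k, N.excess ω η γ k = 0 ↔ N.IsFeedback ω η γ := by
  simp only [Finset.sum_eq_zero_iff_of_nonneg fun k _ => N.excess_nonneg ω η γ k,
    Finset.mem_univ, true_imp_iff, N.excess_eq_zero_iff hu, Noise.IsFeedback]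

variable [IsProbabilityMeasure P]

lemma Noise.IsFeedback.controllerCost_eq {N : Noise M P} {ω : Option Ω} {η : Signaling κ m}
    {γ : Policy κ m r} (h : N.IsFeedback ω η γ) :
    N.controllerCost ω η γ = ENNReal.ofReal (N.minCost ω η) := by
  have hu := h.memLp_control
  rw [N.controllerCost_eq_ofReal_minCost_add hu, (N.sum_excess_eq_zero_iff hu).2 h, add_zero]

lemma Noise.ofReal_minCost_le (ω : Option Ω) (η : Signaling κ m) (γ : Policy κ m r) :
    ENNReal.ofReal (N.minCost ω η) ≤ N.controllerCost ω η γ := by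
  obtain htop | hlt := eq_top_or_lt_top (N.controllerCost ω η γ)
  · exact htop ▸ le_top
  · rw [N.controllerCost_eq_ofReal_minCost_add (N.memLp_control_of_controllerCost_lt_top hlt)]
    exact ENNReal.ofReal_le_ofReal
      (le_add_of_nonneg_right (Finset.sum_nonneg fun k _ => N.excess_nonneg ω η γ k))

lemma Noise.minCost_nonneg (ω : Option Ω) (η : Signaling κ m) : 0 ≤ N.minCost ω η := by
  obtain ⟨γ, hγ⟩ := N.exists_isFeedback ω η
  have hu := hγ.memLp_control
  have hsum := N.sum_integral_quad_eq_minCost_add hu (ω := ω)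
  rw [(N.sum_excess_eq_zero_iff hu).2 hγ, add_zero] at hsum
  exact hsum ▸ Finset.sum_nonneg fun k _ => add_nonneg
    (integral_nonneg fun _ => quad_nonneg (M.Q_posSemidef ω) _)
    (integral_nonneg fun _ => quad_nonneg (M.R_posDef ω).posSemidef _)

lemma Noise.isBestResponse_iff_isFeedback (ω : Option Ω) (η : Signaling κ m)
    (γ : Policy κ m r) : N.IsBestResponse ω η γ ↔ N.IsFeedback ω η γ := by
  refine ⟨fun h => ?_, fun h γ' => h.controllerCost_eq ▸ N.ofReal_minCost_le ω η γ'⟩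
  obtain ⟨γ₀, hγ₀⟩ := N.exists_isFeedback ω η
  have hle : N.controllerCost ω η γ ≤ ENNReal.ofReal (N.minCost ω η) :=
    hγ₀.controllerCost_eq ▸ h γ₀
  have hu := N.memLp_control_of_controllerCost_lt_top (hle.trans_lt ENNReal.ofReal_lt_top)
  rw [N.controllerCost_eq_ofReal_minCost_add hu,
    ENNReal.ofReal_le_ofReal_iff (N.minCost_nonneg ω η)] at hle
  exact (N.sum_excess_eq_zero_iff hu).1 (((add_le_iff_nonpos_right _).1 hle).antisymm
    (Finset.sum_nonneg fun k _ => N.excess_nonneg ω η γ k))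

lemma Noise.exists_isBestResponse (ω : Option Ω) (η : Signaling κ m) :
    ∃ γ : Policy κ m r, N.IsBestResponse ω η γ :=
  (N.exists_isFeedback ω η).imp fun γ => (N.isBestResponse_iff_isFeedback ω η γ).2

end BestResponse

/-! ### The objective of the sensor -/

section Sensor

variable {κ m r : ℕ} {Ω : Type*} {M : Model κ m r Ω} {S : Type*} {mS : MeasurableSpace S}
  {P : Measure S} (N : Noise M P)

/-- The cost `ξ^ω + ∑_k Tr{H_k Ξ_k^ω}` to the sensor of a best response of type `ω`. -/
def Noise.responseCost (N : Noise M P) (ω : Option Ω) (η : Signaling κ m) : ℝ :=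
  N.xi ω + ∑ k : Fin κ, (N.H η k * M.Xi ω k).trace

lemma Noise.trace_freeCov_mul_Abar_Qbar :
    (N.freeCov * M.Abarᵀ * M.Qbar * M.Abar).trace
      = ∑ k : Fin κ, ∫ s, quad (M.Q none) (M.A *ᵥ N.freeState k.castSucc s) ∂P := by
  have hx := memLp_stack fun k : Fin κ => N.memLp_freeState k.castSucc
  have hW : (M.Abarᵀ * M.Qbar * M.Abar)ᵀ = M.Abarᵀ * M.Qbar * M.Abar := by
    simp only [Matrix.transpose_mul, Matrix.transpose_transpose, M.Qbar_isSymm.eq,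
      Matrix.mul_assoc]
  rw [Matrix.mul_assoc, Matrix.mul_assoc, ← Matrix.mul_assoc M.Abarᵀ, ← hW,
    N.freeCov_eq_crossMoment, ← integral_dotProduct_mulVec hx hx, ← integral_finsetSum _ fun k _ =>
      integrable_quad (memLp_mulVec (N.memLp_freeState k.castSucc) M.A) _]
  refine integral_congr_ae (.of_forall fun s => ?_)
  beta_reduce
  rw [← Matrix.mulVec_mulVec, ← Matrix.mulVec_mulVec, Matrix.dotProduct_transpose_mulVec,
    dotProduct_comm, M.Abar_mulVec, M.uncurry_dotProduct_Qbar_mulVec]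

lemma Noise.IsFeedback.stack_drift_ae_eq {N : Noise M P} {ω : Option Ω} {η : Signaling κ m}
    {γ : Policy κ m r} (h : N.IsFeedback ω η γ) :
    stack (fun k s => M.drift (fun j => N.control η γ j s) k.succ)
      =ᵐ[P] fun s => -(M.T ω *ᵥ stack (N.freePosterior η) s) := by
  filter_upwards [ae_all_iff.2 h] with s hs
  have hPhi : M.Phi ω *ᵥ (Function.uncurry fun k => N.control η γ k s)
      = -(M.Kbar ω *ᵥ stack (N.freePosterior η) s) := by
    rw [M.Phi_mulVec, Model.Kbar, ofBlocks_diagonal_mulVec]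
    ext ⟨k, i⟩
    have hk := hs k
    rw [N.posterior_eq_freePosterior] at hk
    exact congrFun hk i
  rw [← M.Z_mulVec_of_Phi_mulVec hPhi, M.Z_mulVec]
  simp only [M.drift_succ_eq_sum_Iic]

lemma Noise.exists_isMaxOn_linearObjective [Fintype Ω]
    (H : Fin κ → Matrix (Fin m) (Fin m) ℝ) :
    ∃ p ∈ stdSimplex ℝ (Option Ω), IsMaxOn (N.linearObjective H) (stdSimplex ℝ (Option Ω)) p := by
  classical
  have hcont : Continuous (N.linearObjective H) := by
    unfold Noise.linearObjective
    fun_prop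
  exact (isCompact_stdSimplex ℝ (Option Ω)).exists_isMaxOn ⟨_, single_mem_stdSimplex ℝ none⟩
    hcont.continuousOn

variable [IsProbabilityMeasure P]

lemma Noise.estimationLoss_eq_trace (ω : Option Ω) (η : Signaling κ m) (k : Fin κ) :
    N.estimationLoss ω η k
      = ((crossMoment P (N.freeState k.castSucc) (N.freeState k.castSucc) - N.H η k)
          * ((M.K ω k)ᵀ * M.Del ω k * M.K ω k)).trace := by
  have hx := N.memLp_freeState k.castSucc
  have hpythagoras := integral_quad_mulVec_eq_add (N.info_le η k) hx (M.Del ω k) (M.K ω k)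
  simp only [quad_mulVec] at hpythagoras
  rw [integral_quad hx, ← Noise.freePosterior, integral_quad (N.memLp_freePosterior η k),
    ← N.H_eq_crossMoment] at hpythagoras
  simp only [Noise.estimationLoss, quad_mulVec]
  rw [Matrix.sub_mul, Matrix.trace_sub, hpythagoras]
  exact (add_sub_cancel_left _ _).symm

lemma Noise.minCost_none (η : Signaling κ m) : N.minCost none η = N.responseCost none η := by
  have hfree (k : Fin κ) : block N.freeCov k k
      = crossMoment P (N.freeState k.castSucc) (N.freeState k.castSucc) := rfl
  have htrace (k : Fin κ) : N.estimationLoss none η k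
      = (N.H η k * M.Xi none k).trace - (block N.freeCov k k * M.Xi none k).trace := by
    rw [N.estimationLoss_eq_trace, hfree, M.Xi_none, Matrix.mul_neg, Matrix.mul_neg,
      Matrix.trace_neg, Matrix.trace_neg, Matrix.sub_mul, Matrix.trace_sub]
    ring
  simp only [Noise.minCost, Noise.responseCost, Noise.xi, trace_mul_ofBlocks_diagonal, htrace,
    Finset.sum_sub_distrib]
  ring

lemma Noise.integral_quad_state_succ {η : Signaling κ m} {γ : Policy κ m r}
    (hu : ∀ k, MemLp (N.control η γ k) 2 P) (W : Matrix (Fin m) (Fin m) ℝ) (k : Fin κ) :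
    ∫ s, quad W (N.state η γ k.succ s) ∂P
      = ∫ s, quad W (M.A *ᵥ N.freeState k.castSucc s) ∂P
        + (∫ s, quad W (M.drift (fun j => N.control η γ j s) k.succ
            + M.A *ᵥ N.freePosterior η k s) ∂P
          - ∫ s, quad W (M.A *ᵥ N.freePosterior η k s) ∂P)
        + (M.covNoise * W).trace := by
  have hx := N.memLp_freeState k.castSucc
  have hz := N.memLp_drift hu k.succ
  have hzm : Measurable[N.info η k] fun s => M.drift (fun j => N.control η γ j s) k.succ :=
    Model.measurable_drift fun j hj =>
      N.measurable_control_info η γ (Fin.castSucc_lt_succ_iff.1 hj)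
  have hzx : MemLp (fun s => M.drift (fun j => N.control η γ j s) k.succ
      + M.A *ᵥ N.freeState k.castSucc s) 2 P := hz.add (memLp_mulVec hx M.A)
  have hzxm : Measurable[N.past η k] fun s => M.drift (fun j => N.control η γ j s) k.succ
      + M.A *ᵥ N.freeState k.castSucc s :=
    (hzm.mono (N.info_le_past η k) le_rfl).add
      (measurable_mulVec (N.measurable_freeState_past η le_rfl) _)
  have hstate (s : S) : N.state η γ k.succ s = M.drift (fun j => N.control η γ j s) k.succ
      + M.A *ᵥ N.freeState k.castSucc s + N.w k s := by
    rw [N.state_eq_freeState_add_drift, N.freeState_succ]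
    abel
  simp only [hstate]
  rw [N.integral_quad_add_w η hzx hzxm,
    integral_quad_add_mulVec (N.info_le η k) hx hz hzm W M.A,
    integral_quad_mulVec_eq_add (N.info_le η k) hx W M.A]
  simp only [Noise.freePosterior]
  ring

lemma Noise.IsFeedback.sum_integral_quad_sub {N : Noise M P} {ω : Ω} {η : Signaling κ m}
    {γ : Policy κ m r} (h : N.IsFeedback (some ω) η γ) :
    ∑ k : Fin κ, (∫ s, quad (M.Q none) (M.drift (fun j => N.control η γ j s) k.succ
          + M.A *ᵥ N.freePosterior η k s) ∂P
        - ∫ s, quad (M.Q none) (M.A *ᵥ N.freePosterior η k s) ∂P)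
      = ∑ k : Fin κ, (N.H η k * M.Xi (some ω) k).trace := by
  have hp (k : Fin κ) : MemLp (fun s => M.A *ᵥ N.freePosterior η k s) 2 P :=
    memLp_mulVec (N.memLp_freePosterior η k) M.A
  have hzp (k : Fin κ) : MemLp (fun s => M.drift (fun j => N.control η γ j s) k.succ
      + M.A *ᵥ N.freePosterior η k s) 2 P := (N.memLp_drift h.memLp_control k.succ).add (hp k)
  have hint (k : Fin κ) : Integrable (fun s =>
      quad (M.Q none) (M.drift (fun j => N.control η γ j s) k.succ
          + M.A *ᵥ N.freePosterior η k s)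
        - quad (M.Q none) (M.A *ᵥ N.freePosterior η k s)) P :=
    (integrable_quad (hzp k) _).sub (integrable_quad (hp k) _)
  simp only [← integral_sub (integrable_quad (hzp _) _) (integrable_quad (hp _) _)]
  rw [← N.integral_dotProduct_V_mulVec, ← integral_finsetSum _ fun k _ => hint k]
  refine integral_congr_ae ?_
  filter_upwards [h.stack_drift_ae_eq] with s hs
  have hsum : (Function.uncurry fun k => M.drift (fun j => N.control η γ j s) k.succ
        + M.A *ᵥ N.freePosterior η k s)
      = M.Abar *ᵥ stack (N.freePosterior η) s - M.T (some ω) *ᵥ stack (N.freePosterior η) s := by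
    rw [sub_eq_neg_add, ← hs, M.Abar_mulVec]
    rfl
  rw [M.dotProduct_V_some_mulVec, ← hsum, M.Abar_mulVec, M.uncurry_dotProduct_Qbar_mulVec,
    M.uncurry_dotProduct_Qbar_mulVec, Finset.sum_sub_distrib]

lemma Noise.IsFeedback.sum_integral_quad_state {N : Noise M P} {ω : Ω} {η : Signaling κ m}
    {γ : Policy κ m r} (h : N.IsFeedback (some ω) η γ) :
    ∑ k : Fin κ, ∫ s, quad (M.Q none) (N.state η γ k.succ s) ∂P = N.responseCost (some ω) η := by
  simp only [N.integral_quad_state_succ h.memLp_control, Finset.sum_add_distrib,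
    h.sum_integral_quad_sub, ← N.trace_freeCov_mul_Abar_Qbar, Noise.responseCost, Noise.xi,
    Finset.sum_const, Finset.card_univ, Fintype.card_fin, nsmul_eq_mul]
  ring

lemma Noise.responseCost_nonneg (ω : Option Ω) (η : Signaling κ m) :
    0 ≤ N.responseCost ω η := by
  cases ω with
  | none => exact N.minCost_none η ▸ N.minCost_nonneg none η
  | some ω =>
    obtain ⟨γ, hγ⟩ := N.exists_isFeedback (some ω) η
    exact hγ.sum_integral_quad_state ▸ Finset.sum_nonneg fun k _ =>
      integral_nonneg fun _ => quad_nonneg (M.Q_posSemidef none) _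

lemma Noise.IsFeedback.sensorCost_eq {N : Noise M P} {ω : Option Ω} {η : Signaling κ m}
    {γ : Policy κ m r} (h : N.IsFeedback ω η γ) :
    N.sensorCost ω η γ = ENNReal.ofReal (N.responseCost ω η) := by
  cases ω with
  | none => exact N.minCost_none η ▸ h.controllerCost_eq
  | some ω =>
    rw [← h.sum_integral_quad_state, ENNReal.ofReal_sum_of_nonneg fun k _ =>
      integral_nonneg fun _ => quad_nonneg (M.Q_posSemidef none) _]
    exact Finset.sum_congr rfl fun k _ =>
      lintegral_quad (N.memLp_state h.memLp_control k.succ) (M.Q_posSemidef none)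

section WorstCase

variable [Fintype Ω]

lemma Noise.coe_sensorMean_eq {η : Signaling κ m} {γ : Option Ω → Policy κ m r}
    (h : ∀ ω, N.IsFeedback ω η (γ ω)) {p : Option Ω → ℝ} (hp : p ∈ stdSimplex ℝ (Option Ω)) :
    (N.sensorMean η γ p : EReal) = (N.linearObjective (N.H η) p : EReal) := by
  have hnonneg (ω : Option Ω) : 0 ≤ p ω * N.responseCost ω η :=
    mul_nonneg (hp.1 ω) (N.responseCost_nonneg ω η)
  have hmean : N.sensorMean η γ p = ENNReal.ofReal (N.linearObjective (N.H η) p) := by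
    simp only [Noise.sensorMean, (h _).sensorCost_eq, ← ENNReal.ofReal_mul (hp.1 _)]
    exact (ENNReal.ofReal_sum_of_nonneg fun ω _ => hnonneg ω).symm
  rw [hmean, EReal.coe_ennreal_ofReal, max_eq_left]
  exact Finset.sum_nonneg fun ω _ => hnonneg ω

lemma Noise.coe_sensorObjective_eq_iSup {η : Signaling κ m} {γ : Option Ω → Policy κ m r}
    (h : ∀ ω, N.IsFeedback ω η (γ ω)) :
    (N.sensorObjective η γ : EReal)
      = ⨆ p : stdSimplex ℝ (Option Ω), (N.linearObjective (N.H η) p : EReal) :=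
  (EReal.coe_ennreal_strictMono.monotone.map_ciSup_of_continuousAt
    continuous_coe_ennreal_ereal.continuousAt).trans
      (iSup_congr fun p => N.coe_sensorMean_eq h p.2)

end WorstCase

end Sensor

end RobustSensor

end

theorem lemma1 {κ m r : ℕ} {Ω : Type*} [Fintype Ω] (M : RobustSensor.Model κ m r Ω)
    {S : Type*} [MeasurableSpace S] (P : Measure S) [IsProbabilityMeasure P]
    (N : RobustSensor.Noise M P) :
    -- the matrices `Ξ_k^ω` are symmetric
    (∀ ω k, (M.Xi ω k).IsSymm) ∧
    -- `H_k` does not depend on the control policy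
    (∀ η γ k, N.posteriorCov η γ k = N.H η k) ∧
    -- best responses exist, and they are the policies with `u°_k = -K_k^ω E{x°_k | s_{1:k}}`
    (∀ ω η, ∃ γ, N.IsBestResponse ω η γ) ∧
    (∀ ω η γ, N.IsBestResponse ω η γ ↔
      ∀ k, N.freeControl ω η γ k =ᵐ[P] fun s => -(M.K ω k *ᵥ N.posterior η γ k s)) ∧
    -- the problem faced by the sensor, for every choice of best responses
    ∀ γ : RobustSensor.Signaling κ m → Option Ω → RobustSensor.Policy κ m r,
      (∀ η ω, N.IsBestResponse ω η (γ η ω)) →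
      -- equality of the objectives for every distribution over the types
      (∀ η, ∀ p ∈ stdSimplex ℝ (Option Ω),
        (N.sensorMean η (γ η) p : EReal) = (N.linearObjective (N.H η) p : EReal)) ∧
      -- equality of the worst cases, which are attained
      (∀ η, ∃ p ∈ stdSimplex ℝ (Option Ω),
        (∀ q ∈ stdSimplex ℝ (Option Ω),
          N.linearObjective (N.H η) q ≤ N.linearObjective (N.H η) p) ∧
        (N.sensorObjective η (γ η) : EReal) = (N.linearObjective (N.H η) p : EReal)) ∧
      -- same minimizers
      (∀ η, (∀ η', N.sensorObjective η (γ η) ≤ N.sensorObjective η' (γ η')) ↔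
        ∀ η', (⨆ p : stdSimplex ℝ (Option Ω), (N.linearObjective (N.H η) p : EReal)) ≤
          ⨆ p : stdSimplex ℝ (Option Ω), (N.linearObjective (N.H η') p : EReal)) ∧
      -- same value
      (⨅ η, (N.sensorObjective η (γ η) : EReal)) =
        ⨅ η, ⨆ p : stdSimplex ℝ (Option Ω), (N.linearObjective (N.H η) p : EReal) := by
  refine ⟨M.Xi_isSymm, N.posteriorCov_eq_H, N.exists_isBestResponse,
    N.isBestResponse_iff_isFeedback, fun γ hγ => ?_⟩
  have hfeedback (η ω) : N.IsFeedback ω η (γ η ω) :=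
    (N.isBestResponse_iff_isFeedback ω η _).1 (hγ η ω)
  have hobj (η) : (N.sensorObjective η (γ η) : EReal)
      = ⨆ p : stdSimplex ℝ (Option Ω), (N.linearObjective (N.H η) p : EReal) :=
    N.coe_sensorObjective_eq_iSup (hfeedback η)
  refine ⟨fun η p => N.coe_sensorMean_eq (hfeedback η), fun η => ?_, fun η => ?_, ?_⟩
  · obtain ⟨p, hp, hmax⟩ := N.exists_isMaxOn_linearObjective (N.H η)
    exact ⟨p, hp, fun q => @hmax q, (hobj η).trans
      ((hmax.comp_mono EReal.coe_strictMono.monotone).iSup_eq hp)⟩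
  · simp only [← hobj, EReal.coe_ennreal_le_coe_ennreal_iff]
  · simp only [hobj]
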